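/- Conventions. Let $q$ be a positive definite quadratic form on $\mathbb{R}^n$, and regard $\mathbb{R}^n$ as a Euclidean space with $\|x\|^2=q(x)$. Let $L\subset\mathbb{R}^n$ be an $n$-dimensional lattice. A sphere $S(c,r)$ is *empty* in $L$ if $\|v-c\|\ge r$ for all $v\in L$ and $S(c,r)\cap L$ has affine rank $n+1$; then $\mathrm{conv}(S(c,r)\cap L)$ is called a *Delaunay polytope* of $L$ (for $q$). A Delaunay polytope $P$ is *extreme* if every affine bijection $f$ of $\mathbb{R}^n$ for which $f(P)$ is again a Delaunay polytope (of some lattice) is the composition of a homothety and an isometry. Let $D_m=\{x\in\mathbb{Z}^m : \sum_i x_i \text{ even}\}$, and let $L_n\subset\mathbb{R}^n$ be the lattice generated by all $(x,0)$ with $x\in D_{n-1}$ and by $(\tfrac12,\dots,\tfrac12,1)$. Let $P_n\subset\mathbb{R}^n$ be the convex hull of the point $(\tfrac12,\dots,\tfrac12,1)$, the $2^{n-2}$ points $(x_1,\dots,x_{n-1},0)$ with $x_i\in\{0,1\}$ and $\sum_i x_i$ even, and the $2(n-1)$ points $(\tfrac12,\dots,\tfrac12,-1)\pm e_j$ with $1\le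 j\le n-1$. Put $q_n(x)=x_1^2+\dots+x_{n-1}^2+\frac{n-3}{4}x_n^2$. **Theorem.** Let $n\ge 6$ be even. (i) $P_n$ is a Delaunay polytope of the lattice $L_n$ for $q_n$, and it is extreme in the Euclidean space $(\mathbb{R}^n,q_n)$. Up to scaling, $q_n$ is the only quadratic form for which $P_n$ is a Delaunay polytope: for every $\alpha>0$, $P_n$ is a Delaunay polytope of $L_n$ for $\alpha q_n$; and if $P_n$ is a Delaunay polytope of some lattice for a positive definite form $q$, then $q=\alpha q_n$ for some $\alpha>0$. (ii) For the form $q_n$, the circumscribed empty sphere of $P_n$ in $L_n$ is unique; its center is $(\tfrac12,\dots,\tfrac12,\tfrac{-1}{n-3})$ and its radius is $\frac{n-2}{2\sqrt{n-3}}$. (iii) For the form $q_n$: $P_6$ is isometric to the Schläfli polytope $2_{21}$ of edge length $\sqrt2$ (the convex hull of the 27 roots of $E_8$ that have inner product $1$ with both of two fixed roots $a,b$ with $\langle a,b\rangle=1$); its group of isometries has order $51840$ and acts transitively on its vertices. If $n>6$, then the group of isometries of $P_n$ is isomorphic to the semidirect product $2^{n-2}\rtimes \mathrm{Sym}(n-1)$,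 where $2^{n-2}=\{s\in\{\pm1\}^{n-1} : \prod_i s_i=1\}$ and $\mathrm{Sym}(n-1)$ permutes the coordinates, and it has exactly three orbits on the vertices of $P_n$. -/

import Mathlib

namespace ExtremeDelaunay

noncomputable section

/-! ### Delaunay polytopes with respect to a quadratic form -/

section General

variable {V : Type*} [NormedAddCommGroup V] [NormedSpace ℝ V]

/-- `L` is a full-dimensional lattice in `V`: a discrete subgroup spanning `V` over `ℝ`. (On a
finite-dimensional `V`, discreteness does not depend on the norm chosen on `V`.) -/
def IsLattice (L : Submodule ℤ V) : Prop :=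
  DiscreteTopology L ∧ Submodule.span ℝ (L : Set V) = ⊤

/-- The points of `L` lying on the sphere with center `c` and radius `r`, for the Euclidean
structure on `V` whose squared norm is `q`. -/
def spherePoints (q : QuadraticForm ℝ V) (L : Submodule ℤ V) (c : V) (r : ℝ) : Set V :=
  {v | v ∈ L ∧ q (v - c) = r ^ 2}

/-- In the Euclidean space `(V, q)` the sphere with center `c` and radius `r` is an empty sphere
of the lattice `L`: no lattice point lies strictly inside, and the lattice points on the sphere
affinely span `V`. -/
structure IsEmptySphere (q : QuadraticForm ℝ V) (L : Submodule ℤ V) (c : V) (r : ℝ) : Prop where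
  posDef : q.PosDef
  lattice : IsLattice L
  radius_nonneg : 0 ≤ r
  empty : ∀ v ∈ L, r ^ 2 ≤ q (v - c)
  span_eq_top : affineSpan ℝ (spherePoints q L c r) = ⊤

/-- The sphere with center `c` and radius `r` is an empty sphere of `L` in `(V, q)`, and the
Delaunay polytope that it defines is `P`. -/
def IsDelaunaySphere (q : QuadraticForm ℝ V) (L : Submodule ℤ V) (P : Set V) (c : V) (r : ℝ) :
    Prop :=
  IsEmptySphere q L c r ∧ P = convexHull ℝ (spherePoints q L c r)

/-- `P` is a Delaunay polytope of the lattice `L` in the Euclidean space `(V, q)`. -/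
def IsDelaunayIn (q : QuadraticForm ℝ V) (L : Submodule ℤ V) (P : Set V) : Prop :=
  ∃ (c : V) (r : ℝ), IsDelaunaySphere q L P c r

/-- `P` is a Delaunay polytope (of some lattice) in the Euclidean space `(V, q)`. -/
def IsDelaunay (q : QuadraticForm ℝ V) (P : Set V) : Prop :=
  ∃ L : Submodule ℤ V, IsDelaunayIn q L P

/-- The affine bijection `f` is an isometry of the Euclidean space `(V, q)`. -/
def IsIsom (q : QuadraticForm ℝ V) (f : V ≃ᵃ[ℝ] V) : Prop :=
  ∀ x y, q (f x - f y) = q (x - y)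

/-- `P` is an extreme Delaunay polytope in `(V, q)`: it is a Delaunay polytope, and every affine
bijection `f` for which `f(P)` is again a Delaunay polytope is, up to an isometry, a homothety. -/
def IsExtremeDelaunay (q : QuadraticForm ℝ V) (P : Set V) : Prop :=
  IsDelaunay q P ∧
    ∀ f : V ≃ᵃ[ℝ] V, IsDelaunay q (f '' P) →
      ∃ (g : V ≃ᵃ[ℝ] V) (c : V) (k : ℝ),
        IsIsom q g ∧ k ≠ 0 ∧ ∀ x, f x = g (AffineMap.homothety c k x)

/-- The group of isometries of `P` in `(V, q)`. -/
def isometryGroup (q : QuadraticForm ℝ V) (P : Set V) : Subgroup (V ≃ᵃ[ℝ] V) where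
  carrier := {f | IsIsom q f ∧ f '' P = P}
  one_mem' := ⟨fun _ _ => rfl, by simp⟩
  mul_mem' := by
    rintro f g ⟨hf, hfP⟩ ⟨hg, hgP⟩
    refine ⟨fun x y => ?_, ?_⟩
    · rw [AffineEquiv.mul_def, AffineEquiv.trans_apply, AffineEquiv.trans_apply, hf, hg]
    · rw [AffineEquiv.mul_def, AffineEquiv.coe_trans, Set.image_comp, hgP, hfP]
  inv_mem' := by
    rintro f ⟨hf, hfP⟩
    refine ⟨fun x y => ?_, ?_⟩
    · rw [AffineEquiv.inv_def, ← hf, f.apply_symm_apply, f.apply_symm_apply]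
    · rw [AffineEquiv.inv_def]
      nth_rewrite 1 [← hfP]
      rw [← Set.image_comp]
      simp

/-- The vertices of the polytope `P`. -/
def vertices (P : Set V) : Set V := Set.extremePoints ℝ P

/-- The orbit of the point `v` under the isometry group of `P`. -/
def vertexOrbit (q : QuadraticForm ℝ V) (P : Set V) (v : V) : Set V :=
  {w | ∃ f ∈ isometryGroup q P, f v = w}

/-- The set of orbits of the isometry group of `P` on the vertices of `P`. -/
def vertexOrbits (q : QuadraticForm ℝ V) (P : Set V) : Set (Set V) :=
  vertexOrbit q P '' vertices P

end General

/-! ### The polytopes `P_n` and the lattices `L_n` -/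

/-- `ℝⁿ` (for `n ≥ 1`), written as `ℝⁿ⁻¹ × ℝ`: the second component is the coordinate `xₙ`. -/
abbrev Space (n : ℕ) : Type := (Fin (n - 1) → ℝ) × ℝ

/-- The root lattice `D_m`: the integer vectors with even coordinate sum. -/
def rootLatticeD (m : ℕ) : Set (Fin m → ℝ) :=
  {x | ∃ z : Fin m → ℤ, (∀ i, x i = z i) ∧ Even (∑ i, z i)}

/-- The vertices of the half-cube `½H_m`: the 0/1 vectors with even coordinate sum. -/
def halfCube (m : ℕ) : Set (Fin m → ℝ) :=
  {x | x ∈ rootLatticeD m ∧ ∀ i, x i = 0 ∨ x i = 1}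

/-- The point `(1/2, …, 1/2, t)`. -/
def halfPoint (n : ℕ) (t : ℝ) : Space n := (fun _ => 1 / 2, t)

/-- The lattice `L_n` generated by all `(x, 0)` with `x ∈ D_{n-1}` and by `(1/2, …, 1/2, 1)`. -/
def latticeL (n : ℕ) : Submodule ℤ (Space n) :=
  Submodule.span ℤ
    ({p | ∃ x ∈ rootLatticeD (n - 1), p = (x, 0)} ∪ {halfPoint n 1})

/-- The three layers of points whose convex hull is `P_n`. -/
def layers (n : ℕ) : Set (Space n) :=
  {halfPoint n 1}
    ∪ {p | ∃ x ∈ halfCube (n - 1), p = (x, 0)}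
    ∪ {p | ∃ j : Fin (n - 1),
        p = halfPoint n (-1) + (Pi.single j 1, 0) ∨ p = halfPoint n (-1) - (Pi.single j 1, 0)}

/-- The polytope `P_n`. -/
def polytopeP (n : ℕ) : Set (Space n) := convexHull ℝ (layers n)

/-- The quadratic form `x₁² + … + xₙ₋₁² + ((n-3)/4) xₙ²`. -/
def formQ (n : ℕ) : QuadraticForm ℝ (Space n) :=
  QuadraticMap.prod (QuadraticMap.weightedSumSquares ℝ (fun _ : Fin (n - 1) => (1 : ℝ)))
    ((((n : ℝ) - 3) / 4) • QuadraticMap.sq)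

theorem formQ_apply (n : ℕ) (x : Space n) :
    formQ n x = ∑ i, x.1 i ^ 2 + ((n : ℝ) - 3) / 4 * x.2 ^ 2 := by
  simp [formQ, QuadraticMap.weightedSumSquares_apply, pow_two]

/-! ### The Schläfli polytope -/

/-- The 240 roots of `E₈`: vectors of squared length `2` whose coordinates are all integers or
all half-odd-integers, with even coordinate sum. -/
def rootsE8 : Set (EuclideanSpace ℝ (Fin 8)) :=
  {v | ((∀ i, ∃ k : ℤ, v i = k) ∨ (∀ i, ∃ k : ℤ, v i = k + 1 / 2)) ∧
    (∃ k : ℤ, ∑ i, v i = 2 * k) ∧ ‖v‖ ^ 2 = 2}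

/-- The Schläfli polytope `2₂₁`, with edge length `√2`, realised as the edge figure of the `E₈`
root polytope `4₂₁`: the convex hull of the 27 roots having inner product `1` with both of two
fixed roots that themselves have inner product `1`. -/
def schlafli : Set (EuclideanSpace ℝ (Fin 8)) :=
  convexHull ℝ {v | v ∈ rootsE8 ∧
    inner ℝ v !₂[1, 1, 0, 0, 0, 0, 0, 0] = 1 ∧ inner ℝ v !₂[1, 0, 1, 0, 0, 0, 0, 0] = 1}

/-! ### The symmetry group `2^{m-1} ⋊ Sym(m)` of the half-cube -/

/-- The group `2^{m-1}` of sign vectors of length `m` with an even number of minus signs. -/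
def evenSigns (m : ℕ) : Subgroup (Fin m → ℤˣ) where
  carrier := {s | ∏ i, s i = 1}
  one_mem' := by simp
  mul_mem' := by
    intro a b ha hb
    simp only [Set.mem_ofPred_eq] at ha hb ⊢
    simp [Finset.prod_mul_distrib, ha, hb]
  inv_mem' := by
    intro a ha
    simp only [Set.mem_ofPred_eq] at ha ⊢
    simp [ha]

/-- `Sym(m)` acts on the even sign vectors by permuting the coordinates. -/
def permSigns (m : ℕ) : Equiv.Perm (Fin m) →* MulAut (evenSigns m) where
  toFun σ :=
    { toFun := fun s => ⟨fun i => s.1 (σ⁻¹ i), by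
        have h : ∏ i, s.1 i = 1 := s.2
        change ∏ i, s.1 (σ⁻¹ i) = 1
        rw [← h]
        exact Equiv.prod_comp σ⁻¹ s.1⟩
      invFun := fun s => ⟨fun i => s.1 (σ i), by
        have h : ∏ i, s.1 i = 1 := s.2
        change ∏ i, s.1 (σ i) = 1
        rw [← h]
        exact Equiv.prod_comp σ s.1⟩
      left_inv := fun s => by ext i; simp
      right_inv := fun s => by ext i; simp
      map_mul' := fun s t => rfl }
  map_one' := rfl
  map_mul' σ τ := by ext s i; simp [MulAut.mul_apply]

end

end ExtremeDelaunay

open ExtremeDelaunay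

namespace ExtremeDelaunay

/-! ### Quadratic forms on a general space: spheres, convex position, transport of Delaunay
polytopes -/

section General

variable {V : Type*} [NormedAddCommGroup V] [NormedSpace ℝ V]

/-! Points on a sphere are in convex position, so a Delaunay polytope has the lattice points on its
sphere as vertices, and every claim about `P_n` reduces to one about the finite set `layers n`.

Emptiness (`latticeL_sphere`) is checked on each slice `xₙ = k`. Relative to the center, the first
coordinates are half-odd-integers for `k = 0`, arbitrary integers with even sum for `k = 1`, and
integers with odd sum for `k = -1` (because `n` is even). The minimal norms `(n-1)/4`, `0`, `1` put
exactly the three layers on the sphere; for `|k| ≥ 2` the last coordinate alone is too large.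

Uniqueness (`form_eq_of_eq_linear_on_layers`): as `0` is a vertex, a form constant on `layers n - c`
agrees on `layers n` with a linear form. The half-cube makes the `e_i` orthogonal, the bottom layer
gives them equal norm and makes them orthogonal to the last axis, and the apex fixes the remaining
coefficient. The linear form determines the center. Extremality follows by pulling the form back
along the affine bijection.

Isometries: distance to the apex depends only on the height, so the stabilizer of the apex preserves
the layers. The bottom cross-polytope turns its elements into signed permutations, and the half-cube
forces evenly many signs (`exists_signedPermEquiv_of_fix_apex`). For `n > 6` the apex is the only
vertex with no vertex at squared distance `2`, so it is always fixed. For `n = 6` the apex is a root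
whose reflection, followed by a translation, moves the apex to `0`. This makes the group transitive
on `27` vertices, with stabilizer of order `1920`. An explicit affine isometry matches the `27`
vertices with the roots spanning `2₂₁`. -/

theorem form_convex_comb (q : QuadraticForm ℝ V) (u w : V) {a b : ℝ} (hab : a + b = 1) :
    q (a • u + b • w) = a * q u + b * q w - a * b * q (u - w) := by
  have h1 := QuadraticMap.map_add q (a • u) (b • w)
  have h2 := QuadraticMap.map_add q u (-w)
  simp only [QuadraticMap.polar_smul_left, QuadraticMap.polar_smul_right, QuadraticMap.map_smul,
    QuadraticMap.polar_neg_right, QuadraticMap.map_neg, smul_eq_mul] at h1 h2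
  rw [h1, sub_eq_add_neg u w, h2]
  obtain rfl : b = 1 - a := by linarith
  ring

theorem form_sub_eq (q : QuadraticForm ℝ V) (u w : V) :
    q (u - w) = q u - QuadraticMap.polar q u w + q w := by
  have h2 := QuadraticMap.map_add q u (-w)
  simp only [QuadraticMap.polar_neg_right, QuadraticMap.map_neg] at h2
  rw [sub_eq_add_neg, h2]
  ring

theorem form_sub_comm (q : QuadraticForm ℝ V) (u w : V) : q (u - w) = q (w - u) := by
  rw [← neg_sub, QuadraticMap.map_neg]

theorem affineEquiv_linear_sub (f : V ≃ᵃ[ℝ] V) (v w : V) : f.linear (v - w) = f v - f w :=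
  (f : V →ᵃ[ℝ] V).linearMap_vsub v w

/-- Points on a sphere are in convex position. -/
theorem extremePoints_convexHull_of_sphere {q : QuadraticForm ℝ V} (hq : q.PosDef) {S : Set V}
    {c : V} {ρ : ℝ} (hS : ∀ v ∈ S, q (v - c) = ρ) :
    Set.extremePoints ℝ (convexHull ℝ S) = S := by
  have hnn : ∀ x, 0 ≤ q x := hq.nonneg
  have key : ∀ (x y : V) {a b : ℝ}, a + b = 1 →
      q (a • x + b • y - c) = a * q (x - c) + b * q (y - c) - a * b * q (x - y) := by
    intro x y a b hab
    have := form_convex_comb q (x - c) (y - c) hab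
    rw [sub_sub_sub_cancel_right] at this
    rw [← this]
    congr 1
    obtain rfl : b = 1 - a := by linarith
    module
  have hconv : Convex ℝ {x | q (x - c) ≤ ρ} := by
    intro x hx y hy a b ha hb hab
    simp only [Set.mem_ofPred_eq] at *
    rw [key x y hab]
    have := mul_nonneg (mul_nonneg ha hb) (hnn (x - y))
    obtain rfl : b = 1 - a := by linarith
    nlinarith
  have hsub : convexHull ℝ S ⊆ {x | q (x - c) ≤ ρ} :=
    convexHull_min (fun v hv => (hS v hv).le) hconv
  refine extremePoints_convexHull_subset.antisymm fun v hv => ?_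
  rw [mem_extremePoints]
  refine ⟨subset_convexHull ℝ S hv, fun x hx y hy hxy => ?_⟩
  obtain ⟨a, b, ha, hb, hab, rfl⟩ := hxy
  have h1 : q (x - c) ≤ ρ := hsub hx
  have h2 : q (y - c) ≤ ρ := hsub hy
  have h3 := hS _ hv
  rw [key x y hab] at h3
  -- Strict convexity: on the sphere the correction term `a * b * q (x - y)` has no room to be
  -- positive.
  have h4 : q (x - y) = 0 := by
    have hab' := mul_pos ha hb
    have := hnn (x - y)
    obtain rfl : b = 1 - a := by linarith
    by_contra hne
    have hpos : 0 < q (x - y) := lt_of_le_of_ne this (Ne.symm hne)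
    nlinarith [mul_pos hab' hpos]
  have h5 : x = y := sub_eq_zero.mp (hq.anisotropic _ h4)
  subst h5
  constructor <;> rw [← add_smul, hab, one_smul]

theorem IsDelaunaySphere.extremePoints_eq {q : QuadraticForm ℝ V} {L : Submodule ℤ V} {P : Set V}
    {c : V} {r : ℝ} (h : IsDelaunaySphere q L P c r) :
    Set.extremePoints ℝ P = spherePoints q L c r := by
  rw [h.2]
  exact extremePoints_convexHull_of_sphere h.1.posDef fun v hv => hv.2

/-- An isometry carries `S` to a set on the sphere about `f c`, so both `S` and `f '' S` are
recovered from their hulls as extreme points. -/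
theorem mem_isometryGroup_convexHull {q : QuadraticForm ℝ V} (hq : q.PosDef) {S : Set V}
    {c : V} {ρ : ℝ} (hS : ∀ v ∈ S, q (v - c) = ρ) (f : V ≃ᵃ[ℝ] V) :
    f ∈ isometryGroup q (convexHull ℝ S) ↔ IsIsom q f ∧ f '' S = S := by
  have him : f '' convexHull ℝ S = convexHull ℝ (f '' S) :=
    AffineMap.image_convexHull (f : V →ᵃ[ℝ] V) S
  refine and_congr_right fun hf => ?_
  rw [him]
  refine ⟨fun h => ?_, fun h => by rw [h]⟩
  have h1 : ∀ v ∈ f '' S, q (v - f c) = ρ := by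
    rintro _ ⟨v, hv, rfl⟩
    rw [hf, hS v hv]
  rw [← extremePoints_convexHull_of_sphere hq h1, h, extremePoints_convexHull_of_sphere hq hS]

theorem IsDelaunayIn.smul {q : QuadraticForm ℝ V} {L : Submodule ℤ V} {P : Set V}
    (h : IsDelaunayIn q L P) {α : ℝ} (hα : 0 < α) : IsDelaunayIn (α • q) L P := by
  obtain ⟨c, r, ⟨h1, h2, h3, h4, h5⟩, h6⟩ := h
  have hr : (Real.sqrt α * r) ^ 2 = α * r ^ 2 := by rw [mul_pow, Real.sq_sqrt hα.le]
  have hs : spherePoints (α • q) L c (Real.sqrt α * r) = spherePoints q L c r := by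
    ext v
    simp only [spherePoints, Set.mem_ofPred_eq, hr, smul_apply, smul_eq_mul]
    rw [mul_right_inj' hα.ne']
  refine ⟨c, Real.sqrt α * r, ⟨h1.smul hα, h2, by positivity, fun v hv => ?_, hs ▸ h5⟩, hs ▸ h6⟩
  rw [hr, smul_apply, smul_eq_mul]
  exact mul_le_mul_of_nonneg_left (h4 v hv) hα.le

/-- An affine bijection mapping a point of the lattice `L` to the origin pulls back Delaunay
polytopes to Delaunay polytopes, for the pulled back form. -/
theorem IsDelaunaySphere.comp [FiniteDimensional ℝ V] {q : QuadraticForm ℝ V} {L : Submodule ℤ V}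
    {P : Set V} {c : V} {r : ℝ} {f : V ≃ᵃ[ℝ] V} (h : IsDelaunaySphere q L (f '' P) c r)
    (h0 : f 0 ∈ L) :
    IsDelaunaySphere (q.comp (f.linear : V →ₗ[ℝ] V))
      (L.comap ((f.linear : V →ₗ[ℝ] V).restrictScalars ℤ)) P (f.symm c) r := by
  obtain ⟨⟨h1, ⟨hL1, hL2⟩, h3, h4, h5⟩, h6⟩ := h
  have hf : ∀ v, f v = f.linear v + f 0 := fun v => by
    rw [← sub_zero v, affineEquiv_linear_sub, sub_zero, sub_add_cancel]
  -- Since `f 0 ∈ L`, the preimages of `L` under `f` and under its linear part coincide; hence the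
  -- preimage under `f` is a subgroup.
  have hmem : ∀ v, v ∈ L.comap ((f.linear : V →ₗ[ℝ] V).restrictScalars ℤ) ↔ f v ∈ L := fun v => by
    rw [hf v, Submodule.add_mem_iff_left _ h0]
    rfl
  have hval : ∀ v, q.comp (f.linear : V →ₗ[ℝ] V) (v - f.symm c) = q (f v - c) := fun v => by
    have : f.linear (v - f.symm c) = f v - c := by
      rw [affineEquiv_linear_sub, f.apply_symm_apply]
    rw [QuadraticMap.comp_apply, ← this]
    rfl
  have hs : spherePoints q L c r = f '' spherePoints (q.comp (f.linear : V →ₗ[ℝ] V))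
      (L.comap ((f.linear : V →ₗ[ℝ] V).restrictScalars ℤ)) (f.symm c) r := by
    ext w
    constructor
    · intro hw
      refine ⟨f.symm w, ⟨?_, ?_⟩, by simp⟩
      · rw [hmem]; simpa using hw.1
      · rw [hval]; simpa using hw.2
    · rintro ⟨v, ⟨hv1, hv2⟩, rfl⟩
      exact ⟨(hmem v).1 hv1, by rw [← hval]; exact hv2⟩
  refine ⟨⟨?_, ⟨?_, ?_⟩, h3, fun v hv => ?_, ?_⟩, ?_⟩
  · intro x hx
    rw [QuadraticMap.comp_apply]
    exact h1 _ (by simpa using hx)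
  · let e : V ≃L[ℝ] V := f.linear.toContinuousLinearEquiv
    have : (L.comap ((f.linear : V →ₗ[ℝ] V).restrictScalars ℤ) : Set V) = e ⁻¹' (L : Set V) := rfl
    exact DiscreteTopology.preimage_of_continuous_injective (L : Set V) e.continuous e.injective
  · have : (L.comap ((f.linear : V →ₗ[ℝ] V).restrictScalars ℤ) : Set V)
        = f.linear.symm '' (L : Set V) := by
      rw [LinearEquiv.image_symm_eq_preimage]; rfl
    rw [this]
    have h7 := Submodule.span_image (f.linear.symm : V →ₗ[ℝ] V) (s := (L : Set V))
    rw [hL2, Submodule.map_top] at h7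
    exact h7.trans (LinearEquiv.range f.linear.symm)
  · rw [hval]
    exact h4 _ ((hmem v).1 hv)
  · rw [hs] at h5
    exact (AffineEquiv.span_eq_top_iff f).2 h5
  · rw [hs] at h6
    have him : f '' convexHull ℝ (spherePoints (q.comp (f.linear : V →ₗ[ℝ] V))
      (L.comap ((f.linear : V →ₗ[ℝ] V).restrictScalars ℤ)) (f.symm c) r) = _ :=
      AffineMap.image_convexHull (f : V →ᵃ[ℝ] V) _
    exact f.injective.image_injective (h6.trans him.symm)

/-- If, up to scaling, `q` is the only form for which `P` is a Delaunay polytope, then `P` is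
extreme. -/
theorem isExtremeDelaunay_of_unique [FiniteDimensional ℝ V] {q : QuadraticForm ℝ V} {P : Set V}
    (hP : IsDelaunay q P) (h0 : 0 ∈ Set.extremePoints ℝ P)
    (huniq : ∀ q' L, IsDelaunayIn q' L P → ∃ α : ℝ, 0 < α ∧ q' = α • q) :
    IsExtremeDelaunay q P := by
  refine ⟨hP, fun f ⟨L, c, r, hf⟩ => ?_⟩
  -- `f` carries the vertex `0` of `P` to a vertex of `f '' P`, and vertices of a Delaunay polytope
  -- are lattice points.
  have hf0 : f 0 ∈ L := by
    have h1 : f 0 ∈ Set.extremePoints ℝ (f '' P) := by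
      rw [mem_extremePoints] at h0 ⊢
      refine ⟨⟨0, h0.1, rfl⟩, ?_⟩
      rintro _ ⟨x, hx, rfl⟩ _ ⟨y, hy, rfl⟩ hxy
      have h2 : (f : V →ᵃ[ℝ] V) '' openSegment ℝ x y = openSegment ℝ (f x) (f y) :=
        image_openSegment ℝ (f : V →ᵃ[ℝ] V) x y
      rw [← h2] at hxy
      obtain ⟨z, hz, hz0⟩ := hxy
      obtain rfl : z = 0 := f.injective hz0
      have := h0.2 x hx y hy hz
      exact ⟨by rw [this.1], by rw [this.2]⟩
    rw [hf.extremePoints_eq] at h1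
    exact h1.1
  -- The pulled back form is `α • q`, so `f` scales lengths by `√α`; undoing the homothety of that
  -- ratio leaves an isometry.
  obtain ⟨α, hα, hq⟩ := huniq _ _ ⟨_, _, hf.comp hf0⟩
  have hk : Real.sqrt α ≠ 0 := (Real.sqrt_pos.2 hα).ne'
  have hlin : ∀ x, q (f.linear x) = α * q x := fun x => by
    have := DFunLike.congr_fun hq x
    simpa using this
  refine ⟨(AffineEquiv.homothetyUnitsMulHom (0 : V) (Units.mk0 _ hk)).symm.trans f, 0,
    Real.sqrt α, fun x y => ?_, hk, fun x => ?_⟩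
  · simp only [AffineEquiv.trans_apply]
    rw [← affineEquiv_linear_sub, hlin, AffineEquiv.coe_homothetyUnitsMulHom_apply_symm]
    simp only [AffineMap.homothety_apply, Units.val_inv_eq_inv_val, Units.val_mk0, vsub_eq_sub,
      sub_zero, vadd_eq_add, add_zero]
    rw [← smul_sub, QuadraticMap.map_smul, ← mul_inv, Real.mul_self_sqrt hα.le, smul_eq_mul,
      mul_inv_cancel_left₀ hα.ne']
  · have := (AffineEquiv.homothetyUnitsMulHom (0 : V) (Units.mk0 _ hk)).symm_apply_apply x
    rw [AffineEquiv.coe_homothetyUnitsMulHom_apply] at this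
    simp only [AffineEquiv.trans_apply]
    exact congrArg f this.symm

end General

/-! ### The lattice `L_n` and its empty sphere -/

theorem mem_latticeL {n : ℕ} {p : Space n} :
    p ∈ latticeL n ↔ ∃ (k : ℤ) (z : Fin (n - 1) → ℤ), Even (∑ i, z i) ∧
      p = (fun i => (z i : ℝ) + k / 2, (k : ℝ)) := by
  constructor
  · intro hp
    induction hp using Submodule.span_induction with
    | mem x hx =>
      rcases hx with ⟨x, ⟨z, hz, he⟩, rfl⟩ | rfl
      · exact ⟨0, z, he, by ext i <;> simp [hz]⟩
      · exact ⟨1, 0, by simp, by ext i <;> simp [halfPoint]⟩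
    | zero => exact ⟨0, 0, by simp, by ext i <;> simp⟩
    | add x y _ _ hx hy =>
      obtain ⟨k, z, he, rfl⟩ := hx
      obtain ⟨k', z', he', rfl⟩ := hy
      refine ⟨k + k', z + z', ?_, ?_⟩
      · simpa [Finset.sum_add_distrib] using he.add he'
      · ext i <;> simp
        ring
    | smul a x _ hx =>
      obtain ⟨k, z, he, rfl⟩ := hx
      refine ⟨a * k, a • z, ?_, ?_⟩
      · simpa [← Finset.mul_sum] using he.mul_left a
      · ext i <;> simp
        ring
  · rintro ⟨k, z, he, rfl⟩
    have h1 : ((fun i => (z i : ℝ), 0) : Space n) ∈ latticeL n :=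
      Submodule.subset_span (Or.inl ⟨_, ⟨z, fun _ => rfl, he⟩, rfl⟩)
    have h2 : halfPoint n 1 ∈ latticeL n := Submodule.subset_span (Or.inr rfl)
    convert (latticeL n).add_mem h1 ((latticeL n).smul_mem k h2) using 1
    ext i <;> simp [halfPoint]
    ring

/-- The center of the empty sphere circumscribed about `P_n`. -/
noncomputable def center (n : ℕ) : Space n := halfPoint n (-1 / ((n : ℝ) - 3))

theorem formQ_posDef {n : ℕ} (h6 : 6 ≤ n) : (formQ n).PosDef := by
  have h6' : (6 : ℝ) ≤ n := by exact_mod_cast h6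
  intro x hx
  rw [formQ_apply]
  have h1 : 0 ≤ ∑ i, x.1 i ^ 2 := Finset.sum_nonneg fun i _ => sq_nonneg _
  have h2 : 0 ≤ ((n : ℝ) - 3) / 4 * x.2 ^ 2 := by
    have : 0 ≤ (n : ℝ) - 3 := by linarith
    positivity
  refine lt_of_le_of_ne (add_nonneg h1 h2) fun h => hx ?_
  have h3 : ∑ i, x.1 i ^ 2 = 0 := by linarith
  have h4 : ((n : ℝ) - 3) / 4 * x.2 ^ 2 = 0 := by linarith
  rw [Finset.sum_eq_zero_iff_of_nonneg fun i _ => sq_nonneg _] at h3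
  have h5 : x.2 = 0 := by
    have : ((n : ℝ) - 3) / 4 ≠ 0 := by
      have : 0 < (n : ℝ) - 3 := by linarith
      positivity
    simpa [this] using h4
  ext i
  · simpa using h3 i (Finset.mem_univ i)
  · exact h5

theorem card_cast {n : ℕ} (h6 : 6 ≤ n) : (((n - 1 : ℕ) : ℕ) : ℝ) = (n : ℝ) - 1 := by
  rw [Nat.cast_sub (by omega)]; simp

/-- Coordinatewise estimate for the slice `k = 0`; the equality case produces the half-cube. -/
theorem quarter_le_sq (z : ℤ) : (1 / 4 : ℝ) ≤ ((z : ℝ) - 1 / 2) ^ 2 ∧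
    (((z : ℝ) - 1 / 2) ^ 2 = 1 / 4 → z = 0 ∨ z = 1) := by
  have h : (((z : ℝ) - 1 / 2) ^ 2) = ((z * (z - 1) : ℤ) : ℝ) + 1 / 4 := by push_cast; ring
  rw [h]
  constructor
  · have : (0 : ℤ) ≤ z * (z - 1) := by
      rcases le_or_gt z 0 with h | h
      · exact mul_nonneg_of_nonpos_of_nonpos h (by omega)
      · exact mul_nonneg (by omega) (by omega)
    have : (0 : ℝ) ≤ ((z * (z - 1) : ℤ) : ℝ) := by exact_mod_cast this
    linarith
  · intro h
    have : ((z * (z - 1) : ℤ) : ℝ) = 0 := by linarith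
    have : z * (z - 1) = 0 := by exact_mod_cast this
    rcases mul_eq_zero.1 this with h | h
    · exact Or.inl h
    · exact Or.inr (by omega)

/-- An integer vector with odd coordinate sum has norm at least `1`, with equality only for the
signed unit vectors. -/
theorem one_le_sum_sq {m : ℕ} {y : Fin m → ℤ} (hy : Odd (∑ i, y i)) :
    1 ≤ ∑ i, y i ^ 2 ∧
      (∑ i, y i ^ 2 = 1 → ∃ j, y = Pi.single j 1 ∨ y = -Pi.single j 1) := by
  obtain ⟨j, hj⟩ : ∃ j, y j ≠ 0 := by
    by_contra! h
    simp [h] at hy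
  have h1 : 1 ≤ y j ^ 2 := by
    have := sq_nonneg (y j)
    have : y j ^ 2 ≠ 0 := pow_ne_zero 2 hj
    omega
  have h2 : y j ^ 2 + ∑ i ∈ Finset.univ.erase j, y i ^ 2 = ∑ i, y i ^ 2 :=
    Finset.add_sum_erase _ (fun i => y i ^ 2) (Finset.mem_univ j)
  have h3 : 0 ≤ ∑ i ∈ Finset.univ.erase j, y i ^ 2 := Finset.sum_nonneg fun i _ => sq_nonneg _
  refine ⟨by omega, fun h => ⟨j, ?_⟩⟩
  have h4 : ∑ i ∈ Finset.univ.erase j, y i ^ 2 = 0 := by omega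
  have h5 : y j ^ 2 = 1 := by omega
  rw [Finset.sum_eq_zero_iff_of_nonneg fun i _ => sq_nonneg _] at h4
  have h6 : ∀ i, i ≠ j → y i = 0 := fun i hi => by
    have := h4 i (by simp [hi])
    simpa using this
  refine (by simpa using h5 : y j = 1 ∨ y j = -1).imp (fun h => ?_) (fun h => ?_)
  · ext i
    by_cases hi : i = j
    · subst hi; simp [h]
    · simp [hi, h6 i hi]
  · ext i
    by_cases hi : i = j
    · subst hi; simp [h]
    · simp [hi, h6 i hi]

theorem formQ_sub_center {n : ℕ} (k : ℝ) (z : Fin (n - 1) → ℝ) :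
    formQ n ((fun i => z i + k / 2, k) - center n) =
      ∑ i, (z i + (k - 1) / 2) ^ 2 + ((n : ℝ) - 3) / 4 * (k + 1 / ((n : ℝ) - 3)) ^ 2 := by
  rw [formQ_apply]
  simp only [center, halfPoint, Prod.fst_sub, Prod.snd_sub, Pi.sub_apply]
  congr 1
  · exact Finset.sum_congr rfl fun i _ => by ring
  · ring

/-- Here `|k (N - 3) + 1| ≥ 2N - 7`, which exceeds `N - 2` once `N > 5`. The left side is the
squared radius, so slices with `|k| ≥ 2` miss the closed ball. -/
theorem last_coord_bound {N k : ℝ} (hN : 6 ≤ N) (hk : 2 ≤ |k|) :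
    (N - 2) ^ 2 / (4 * (N - 3)) < (N - 3) / 4 * (k + 1 / (N - 3)) ^ 2 := by
  have h3 : 0 < N - 3 := by linarith
  have h : (N - 3) / 4 * (k + 1 / (N - 3)) ^ 2 = (k * (N - 3) + 1) ^ 2 / (4 * (N - 3)) := by
    field_simp
  rw [h]
  refine div_lt_div_of_pos_right ?_ (by positivity)
  rw [sq_lt_sq, abs_of_pos (by linarith : 0 < N - 2)]
  rcases le_abs.1 hk with h | h
  · exact lt_of_lt_of_le (by nlinarith) (le_abs_self _)
  · exact lt_of_lt_of_le (by nlinarith) (neg_le_abs _)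

/-- The squared radius equals the slice minimum plus the height term for each of `k = 0, 1, -1`; the
equality cases of the slice bounds are the three layers. -/
theorem latticeL_sphere {n : ℕ} (hn : Even n) (h6 : 6 ≤ n) {p : Space n} (hp : p ∈ latticeL n) :
    ((n : ℝ) - 2) ^ 2 / (4 * ((n : ℝ) - 3)) ≤ formQ n (p - center n) ∧
      (formQ n (p - center n) = ((n : ℝ) - 2) ^ 2 / (4 * ((n : ℝ) - 3)) → p ∈ layers n) := by
  obtain ⟨k, z, he, rfl⟩ := mem_latticeL.1 hp
  rw [formQ_sub_center (k : ℝ) (fun i => (z i : ℝ))]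
  have hN : (6 : ℝ) ≤ n := by exact_mod_cast h6
  have hc := card_cast h6
  have hN3 : 0 < (n : ℝ) - 3 := by linarith
  rcases le_or_gt 2 |k| with hk | hk
  · have h1 : 0 ≤ ∑ i, ((z i : ℝ) + ((k : ℝ) - 1) / 2) ^ 2 :=
      Finset.sum_nonneg fun i _ => sq_nonneg _
    have h2 := last_coord_bound hN (k := (k : ℝ)) (by exact_mod_cast hk)
    exact ⟨by linarith, fun h => by linarith⟩
  · obtain rfl | rfl | rfl : k = 0 ∨ k = 1 ∨ k = -1 := by rw [abs_lt] at hk; omega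
    · have h1 : ∀ i, (1 / 4 : ℝ) ≤ ((z i : ℝ) + (((0 : ℤ) : ℝ) - 1) / 2) ^ 2 := fun i => by
        have := (quarter_le_sq (z i)).1
        convert this using 2; push_cast; ring
      have h2 : ∑ i : Fin (n - 1), (1 / 4 : ℝ) = ((n : ℝ) - 1) / 4 := by
        simp [hc]; ring
      have h3 := Finset.sum_le_sum fun i (_ : i ∈ Finset.univ) => h1 i
      have h4 : ((n : ℝ) - 2) ^ 2 / (4 * ((n : ℝ) - 3)) = ((n : ℝ) - 1) / 4 +
          ((n : ℝ) - 3) / 4 * (((0 : ℤ) : ℝ) + 1 / ((n : ℝ) - 3)) ^ 2 := by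
        push_cast
        field_simp
        ring
      refine ⟨by rw [h4]; linarith, fun h => ?_⟩
      have h5 := (Finset.sum_eq_sum_iff_of_le fun i (_ : i ∈ Finset.univ) => h1 i).1 (by linarith)
      have h7 : ∀ i, z i = 0 ∨ z i = 1 := fun i => (quarter_le_sq (z i)).2 (by
        rw [h5 i (Finset.mem_univ i)]; push_cast; ring)
      refine Or.inl (Or.inr ⟨fun i => (z i : ℝ), ⟨⟨z, fun _ => rfl, he⟩, fun i => ?_⟩, ?_⟩)
      · rcases h7 i with h | h <;> simp [h]
      · ext i <;> simp
    · have h1 : 0 ≤ ∑ i, ((z i : ℝ) + (((1 : ℤ) : ℝ) - 1) / 2) ^ 2 :=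
        Finset.sum_nonneg fun i _ => sq_nonneg _
      have h4 : ((n : ℝ) - 2) ^ 2 / (4 * ((n : ℝ) - 3)) =
          ((n : ℝ) - 3) / 4 * (((1 : ℤ) : ℝ) + 1 / ((n : ℝ) - 3)) ^ 2 := by
        push_cast
        field_simp
        ring
      refine ⟨by linarith, fun h => ?_⟩
      have h5 : ∑ i, ((z i : ℝ) + (((1 : ℤ) : ℝ) - 1) / 2) ^ 2 = 0 := by linarith
      rw [Finset.sum_eq_zero_iff_of_nonneg fun i _ => sq_nonneg _] at h5
      refine Or.inl (Or.inl ?_)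
      have h7 : ∀ i, (z i : ℝ) = 0 := fun i => by simpa using h5 i (Finset.mem_univ i)
      ext i <;> simp [halfPoint, h7]
    -- Slice `k = -1`: the shift by `1` in `n - 1` (oddly many) coordinates makes the sum odd, which
    -- rules out the zero vector.
    · have hodd : Odd (∑ i, (z i - 1)) := by
        have : ∑ i, (z i - 1) = ∑ i, z i - ((n - 1 : ℕ) : ℤ) := by simp
        rw [this]
        refine he.sub_odd ?_
        rw [Int.odd_coe_nat]
        exact Nat.Even.sub_odd (by omega) hn odd_one
      obtain ⟨h1, h2⟩ := one_le_sum_sq (y := fun i => z i - 1) hodd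
      have h3 : ∑ i, ((z i : ℝ) + (((-1 : ℤ) : ℝ) - 1) / 2) ^ 2 =
          ((∑ i, (z i - 1) ^ 2 : ℤ) : ℝ) := by
        push_cast
        exact Finset.sum_congr rfl fun i _ => by ring
      have h1' : (1 : ℝ) ≤ ((∑ i, (z i - 1) ^ 2 : ℤ) : ℝ) := by exact_mod_cast h1
      have h4 : ((n : ℝ) - 2) ^ 2 / (4 * ((n : ℝ) - 3)) = 1 +
          ((n : ℝ) - 3) / 4 * (((-1 : ℤ) : ℝ) + 1 / ((n : ℝ) - 3)) ^ 2 := by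
        push_cast
        field_simp
        ring
      rw [h3]
      refine ⟨by linarith, fun h => ?_⟩
      have h5 : ((∑ i, (z i - 1) ^ 2 : ℤ) : ℝ) = 1 := by linarith
      obtain ⟨j, hj⟩ := h2 (by exact_mod_cast h5)
      have hsingle : ∀ i, ((Pi.single j 1 : Fin (n - 1) → ℤ) i : ℝ) =
          (Pi.single j 1 : Fin (n - 1) → ℝ) i := fun i => by
        by_cases h : i = j
        · subst h; simp
        · simp [h]
      refine Or.inr ⟨j, hj.imp (fun hj => ?_) (fun hj => ?_)⟩
      · have h7 : ∀ i, (z i : ℝ) = 1 + (Pi.single j 1 : Fin (n - 1) → ℝ) i := fun i => by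
          have := congrFun hj i
          rw [← hsingle, ← this]
          push_cast; ring
        ext i
        · simp only [halfPoint, h7, Prod.fst_add, Pi.add_apply]; push_cast; ring
        · simp [halfPoint]
      · have h7 : ∀ i, (z i : ℝ) = 1 - (Pi.single j 1 : Fin (n - 1) → ℝ) i := fun i => by
          have := congrFun hj i
          simp only [Pi.neg_apply] at this
          have h8 : (z i : ℝ) - 1 = -((Pi.single j 1 : Fin (n - 1) → ℤ) i : ℝ) := by
            exact_mod_cast this
          rw [← hsingle]
          linarith
        ext i
        · simp only [halfPoint, h7, Prod.fst_sub, Pi.sub_apply]; push_cast; ring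
        · simp [halfPoint]

theorem layers_subset_latticeL {n : ℕ} (hn : Even n) (h6 : 6 ≤ n) : layers n ⊆ latticeL n := by
  have hodd : Odd (((n - 1 : ℕ) : ℤ)) := by
    rw [Int.odd_coe_nat]
    exact Nat.Even.sub_odd (by omega) hn odd_one
  rintro p ((rfl | ⟨x, hx, rfl⟩) | ⟨j, rfl | rfl⟩)
  · exact Submodule.subset_span (Or.inr rfl)
  · exact Submodule.subset_span (Or.inl ⟨x, hx.1, rfl⟩)
  · refine mem_latticeL.2 ⟨-1, fun i => 1 + (Pi.single j 1 : Fin (n - 1) → ℤ) i, ?_, ?_⟩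
    · simpa [Finset.sum_add_distrib] using hodd.add_odd odd_one
    · ext i
      · by_cases h : i = j
        · subst h; simp [halfPoint]; norm_num
        · simp [halfPoint, h]; norm_num
      · simp [halfPoint]
  · refine mem_latticeL.2 ⟨-1, fun i => 1 - (Pi.single j 1 : Fin (n - 1) → ℤ) i, ?_, ?_⟩
    · simpa [Finset.sum_sub_distrib] using hodd.sub_odd odd_one
    · ext i
      · by_cases h : i = j
        · subst h; simp [halfPoint]; norm_num
        · simp [halfPoint, h]; norm_num
      · simp [halfPoint]

theorem layers_sphere {n : ℕ} (h6 : 6 ≤ n) {p : Space n} (hp : p ∈ layers n) :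
    formQ n (p - center n) = ((n : ℝ) - 2) ^ 2 / (4 * ((n : ℝ) - 3)) := by
  have hN : (6 : ℝ) ≤ n := by exact_mod_cast h6
  have hc := card_cast h6
  have hN3 : (n : ℝ) - 3 ≠ 0 := by linarith
  rw [formQ_apply]
  rcases hp with (rfl | ⟨x, hx, rfl⟩) | ⟨j, rfl | rfl⟩
  · simp [center, halfPoint]
    field_simp
    ring
  · have h1 : ∀ i, (x i - 1 / 2) ^ 2 = 1 / 4 := fun i => by
      rcases hx.2 i with h | h <;> rw [h] <;> norm_num
    simp only [center, halfPoint, Prod.fst_sub, Prod.snd_sub, Pi.sub_apply, h1]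
    simp [hc]
    field_simp
    ring
  · have h1 : ∀ i, ((halfPoint n (-1) + (Pi.single j 1, 0) - center n).1 i) ^ 2 =
        (Pi.single j 1 : Fin (n - 1) → ℝ) i := fun i => by
      by_cases h : i = j
      · subst h; simp [halfPoint, center]
      · simp [halfPoint, center, h]
    simp only [h1]
    simp [halfPoint, center]
    field_simp
    ring
  · have h1 : ∀ i, ((halfPoint n (-1) - (Pi.single j 1, 0) - center n).1 i) ^ 2 =
        (Pi.single j 1 : Fin (n - 1) → ℝ) i := fun i => by
      by_cases h : i = j
      · subst h; simp [halfPoint, center]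
      · simp [halfPoint, center, h]
    simp only [h1]
    simp [halfPoint, center]
    field_simp
    ring

theorem extremePoints_polytopeP {n : ℕ} (h6 : 6 ≤ n) :
    Set.extremePoints ℝ (polytopeP n) = layers n :=
  extremePoints_convexHull_of_sphere (formQ_posDef h6) fun _ hv => layers_sphere h6 hv

theorem zero_mem_layers (n : ℕ) : (0 : Space n) ∈ layers n :=
  Or.inl (Or.inr ⟨0, ⟨⟨0, by simp, by simp⟩, by simp⟩, rfl⟩)

theorem pair_mem_layers {n : ℕ} {i j : Fin (n - 1)} (hij : i ≠ j) :
    ((Pi.single i 1, 0) + (Pi.single j 1, 0) : Space n) ∈ layers n := by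
  refine Or.inl (Or.inr ⟨Pi.single i 1 + Pi.single j 1,
    ⟨⟨Pi.single i 1 + Pi.single j 1, fun k => ?_, ?_⟩, fun k => ?_⟩, by simp⟩)
  · by_cases h : k = i <;> by_cases h' : k = j <;> simp_all
  · simp [Finset.sum_add_distrib]
  · by_cases h : k = i <;> by_cases h' : k = j <;> simp_all

theorem exists_notMem_of_card_lt {m : ℕ} (s : Finset (Fin m)) (hs : s.card < m) :
    ∃ j, j ∉ s := by
  by_contra! h
  rw [Finset.eq_univ_iff_forall.2 h] at hs
  simp at hs

theorem space_decomp {n : ℕ} (v : Space n) :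
    v = ∑ i, v.1 i • ((Pi.single i 1, 0) : Space n) + v.2 • ((0, 1) : Space n) := by
  ext i
  · simp [Prod.fst_sum, Finset.sum_apply, Pi.single_apply]
  · simp [Prod.snd_sum]

theorem affineSpan_layers {n : ℕ} (h6 : 6 ≤ n) : affineSpan ℝ (layers n) = ⊤ := by
  rw [AffineSubspace.affineSpan_eq_top_iff_vectorSpan_eq_top_of_nonempty ℝ _ _
    ⟨0, zero_mem_layers n⟩, eq_top_iff]
  set W := vectorSpan ℝ (layers n)
  have hW : ∀ v ∈ layers n, v ∈ W := fun v hv => by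
    simpa using vsub_mem_vectorSpan ℝ hv (zero_mem_layers n)
  have hE : ∀ i, ((Pi.single i 1, 0) : Space n) ∈ W := fun i => by
    obtain ⟨j, hj⟩ := exists_notMem_of_card_lt {i} (by simp; omega)
    obtain ⟨k, hk⟩ := exists_notMem_of_card_lt {i, j}
      ((Finset.card_le_two).trans_lt (by omega))
    simp only [Finset.mem_singleton, Finset.mem_insert, not_or] at hj hk
    -- `e_i = ((e_i + e_j) + (e_i + e_k) - (e_j + e_k)) / 2`, all three pairs being half-cube
    -- vertices.
    have h := W.smul_mem (1 / 2 : ℝ) (W.sub_mem (W.add_mem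
      (hW _ (pair_mem_layers (i := i) (j := j) (Ne.symm hj)))
      (hW _ (pair_mem_layers (i := i) (j := k) (Ne.symm hk.1))))
      (hW _ (pair_mem_layers (i := j) (j := k) (Ne.symm hk.2))))
    convert h using 1
    module
  have hU : ((0, 1) : Space n) ∈ W := by
    have h1 := hW (halfPoint n 1) (Or.inl (Or.inl rfl))
    rw [space_decomp (halfPoint n 1), Submodule.add_mem_iff_right _
      (Submodule.sum_mem _ fun i _ => W.smul_mem _ (hE i))] at h1
    simpa [halfPoint] using h1
  intro v _
  rw [space_decomp v]
  exact W.add_mem (Submodule.sum_mem _ fun i _ => W.smul_mem _ (hE i)) (W.smul_mem _ hU)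

/-- The norm is the sup norm of the product: the last coordinate is an integer, and when it vanishes
all the others are integers too. This gives discreteness. -/
theorem one_le_norm_of_mem_latticeL {n : ℕ} {p : Space n} (hp : p ∈ latticeL n) (h0 : p ≠ 0) :
    1 ≤ ‖p‖ := by
  obtain ⟨k, z, -, rfl⟩ := mem_latticeL.1 hp
  have hint : ∀ a : ℤ, a ≠ 0 → (1 : ℝ) ≤ ‖(a : ℝ)‖ := fun a ha => by
    rw [Real.norm_eq_abs]
    exact_mod_cast Int.one_le_abs ha
  by_cases hk : k = 0
  · subst hk
    obtain ⟨i, hi⟩ : ∃ i, z i ≠ 0 := by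
      by_contra! h
      exact h0 (by ext i <;> simp [h])
    refine (hint _ hi).trans (le_trans ?_ (norm_fst_le _))
    simpa using norm_le_pi_norm (fun i => (z i : ℝ) + ((0 : ℤ) : ℝ) / 2) i
  · exact (hint _ hk).trans (norm_snd_le ((fun i => (z i : ℝ) + k / 2, (k : ℝ)) : Space n))

theorem isLattice_latticeL {n : ℕ} (hn : Even n) (h6 : 6 ≤ n) : IsLattice (latticeL n) := by
  constructor
  · refine DiscreteTopology.of_forall_le_dist (r := 1) one_pos fun x y hxy => ?_
    change 1 ≤ dist (x : Space n) y
    rw [dist_eq_norm]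
    exact one_le_norm_of_mem_latticeL ((latticeL n).sub_mem x.2 y.2)
      (sub_ne_zero.2 fun h => hxy (Subtype.ext h))
  · rw [eq_top_iff]
    intro v _
    have h1 : v ∈ affineSpan ℝ (layers n) := by rw [affineSpan_layers h6]; trivial
    exact Submodule.span_mono (layers_subset_latticeL hn h6) (affineSpan_subset_span h1)

theorem spherePoints_latticeL {n : ℕ} (hn : Even n) (h6 : 6 ≤ n) {r : ℝ}
    (hr : r ^ 2 = ((n : ℝ) - 2) ^ 2 / (4 * ((n : ℝ) - 3))) :
    spherePoints (formQ n) (latticeL n) (center n) r = layers n := by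
  ext p
  refine ⟨fun hp => (latticeL_sphere hn h6 hp.1).2 (hp.2.trans hr), fun hp => ?_⟩
  exact ⟨layers_subset_latticeL hn h6 hp, by rw [layers_sphere h6 hp, hr]⟩

theorem isDelaunaySphere_polytopeP {n : ℕ} (hn : Even n) (h6 : 6 ≤ n) :
    IsDelaunaySphere (formQ n) (latticeL n) (polytopeP n) (center n)
      (((n : ℝ) - 2) / (2 * Real.sqrt ((n : ℝ) - 3))) := by
  have hN : (6 : ℝ) ≤ n := by exact_mod_cast h6
  have hr : (((n : ℝ) - 2) / (2 * Real.sqrt ((n : ℝ) - 3))) ^ 2 =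
      ((n : ℝ) - 2) ^ 2 / (4 * ((n : ℝ) - 3)) := by
    rw [div_pow, mul_pow, Real.sq_sqrt (by linarith)]; norm_num
  have hs := spherePoints_latticeL hn h6 hr
  refine ⟨⟨formQ_posDef h6, isLattice_latticeL hn h6, ?_, fun v hv => ?_, ?_⟩, by rw [hs]; rfl⟩
  · have : 0 ≤ (n : ℝ) - 2 := by linarith
    positivity
  · rw [hr]
    exact (latticeL_sphere hn h6 hv).1
  · rw [hs]
    exact affineSpan_layers h6

/-! ### Rigidity: the vertices determine the form up to scale, and the center -/

theorem quadruple_mem_layers {n : ℕ} {i j k o : Fin (n - 1)} (hij : i ≠ j) (hik : i ≠ k)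
    (hio : i ≠ o) (hjk : j ≠ k) (hjo : j ≠ o) (hko : k ≠ o) :
    ((Pi.single i 1, 0) + (Pi.single j 1, 0) + (Pi.single k 1, 0) + (Pi.single o 1, 0) : Space n)
      ∈ layers n := by
  have key : ∀ (R : Type) [Ring R] (p : Fin (n - 1)),
      (Pi.single i 1 + Pi.single j 1 + Pi.single k 1 + Pi.single o 1 : Fin (n - 1) → R) p =
        if p = i ∨ p = j ∨ p = k ∨ p = o then 1 else 0 := by
    intro R _ p
    simp only [Pi.add_apply, Pi.single_apply]
    split_ifs <;> simp_all
  refine Or.inl (Or.inr ⟨Pi.single i 1 + Pi.single j 1 + Pi.single k 1 + Pi.single o 1,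
    ⟨⟨Pi.single i 1 + Pi.single j 1 + Pi.single k 1 + Pi.single o 1, fun p => ?_, ?_⟩,
      fun p => ?_⟩, by simp⟩)
  · rw [key, key]; split_ifs <;> simp
  · simp only [Pi.add_apply, Finset.sum_add_distrib, Finset.sum_pi_single', Finset.mem_univ]
    decide
  · rw [key]; split_ifs <;> simp

/-- A quadratic form agreeing with a linear form on the vertices of `P_n` is a multiple of `q_n`;
the linear form is then determined as well. -/
theorem form_eq_of_eq_linear_on_layers {n : ℕ} (h6 : 6 ≤ n) {q : QuadraticForm ℝ (Space n)}
    {l : Space n →ₗ[ℝ] ℝ} (h : ∀ v ∈ layers n, q v = l v) :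
    ∃ a : ℝ, q = a • formQ n ∧ (∀ i, l (Pi.single i 1, 0) = a) ∧
      l (0, 1) = -(a / 2) := by
  have hN : (6 : ℝ) ≤ n := by exact_mod_cast h6
  have hc := card_cast h6
  set B := QuadraticMap.polarBilin q with hB
  have hadd : ∀ u v, q (u + v) = q u + q v + B u v := QuadraticMap.map_add q
  have hcomm : ∀ u v, B u v = B v u := QuadraticMap.polar_comm q
  have hself : ∀ u, B u u = 2 * q u := fun u => by
    change QuadraticMap.polar q u u = 2 * q u
    rw [QuadraticMap.polar_self, nsmul_eq_mul, Nat.cast_ofNat]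
  set E : Fin (n - 1) → Space n := fun i => (Pi.single i 1, 0) with hE
  set U : Space n := (0, 1) with hU
  -- The `E i` are not vertices; `G` measures by how much `q = l` fails there.
  set G : Fin (n - 1) → ℝ := fun i => q (E i) - l (E i) with hG
  have hpair : ∀ i j, i ≠ j → B (E i) (E j) = -(G i + G j) := fun i j hij => by
    have h1 := h _ (pair_mem_layers hij)
    have h2 := hadd (E i) (E j)
    simp only [hG]
    change q (E i + E j) = l (E i + E j) at h1
    rw [map_add l] at h1
    linarith
  -- Each index lies in three of the six pairs, so the vertex equation reads `ΣG - 3ΣG = 0`.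
  have hquad : ∀ i j k o, i ≠ j → i ≠ k → i ≠ o → j ≠ k → j ≠ o → k ≠ o →
      G i + G j + G k + G o = 0 := fun i j k o hij hik hio hjk hjo hko => by
    have h1 := h _ (quadruple_mem_layers hij hik hio hjk hjo hko)
    change q (E i + E j + E k + E o) = l (E i + E j + E k + E o) at h1
    rw [hadd, hadd, hadd] at h1
    simp only [map_add, LinearMap.add_apply] at h1
    rw [hpair _ _ hij, hpair _ _ hik, hpair _ _ hio, hpair _ _ hjk, hpair _ _ hjo,
      hpair _ _ hko] at h1
    simp only [hG] at h1 ⊢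
    linarith
  -- Among five indices (`n - 1 ≥ 5`), all five sums of four vanish, hence so does each term.
  have hG0 : ∀ i, G i = 0 := fun i => by
    obtain ⟨j, hj⟩ := exists_notMem_of_card_lt {i} (by simp; omega)
    obtain ⟨k, hk⟩ := exists_notMem_of_card_lt {i, j} (Finset.card_le_two.trans_lt (by omega))
    obtain ⟨o, ho⟩ := exists_notMem_of_card_lt {i, j, k} (Finset.card_le_three.trans_lt (by omega))
    obtain ⟨p, hp⟩ := exists_notMem_of_card_lt {i, j, k, o}
      (Finset.card_le_four.trans_lt (by omega))
    simp only [Finset.mem_singleton, Finset.mem_insert, not_or] at hj hk ho hp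
    have h1 := hquad i j k o (by tauto) (by tauto) (by tauto) (by tauto) (by tauto) (by tauto)
    have h2 := hquad i j k p (by tauto) (by tauto) (by tauto) (by tauto) (by tauto) (by tauto)
    have h3 := hquad i j o p (by tauto) (by tauto) (by tauto) (by tauto) (by tauto) (by tauto)
    have h4 := hquad i k o p (by tauto) (by tauto) (by tauto) (by tauto) (by tauto) (by tauto)
    have h5 := hquad j k o p (by tauto) (by tauto) (by tauto) (by tauto) (by tauto) (by tauto)
    linarith
  have hlE : ∀ i, l (E i) = q (E i) := fun i => by linarith [hG0 i]
  have horth : ∀ i j, i ≠ j → B (E i) (E j) = 0 := fun i j hij => by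
    rw [hpair i j hij, hG0, hG0]; simp
  set H : Space n := (1 / 2 : ℝ) • ∑ i, E i with hH
  have hHval : H = (fun _ => 1 / 2, 0) := by
    ext i
    · simp [hH, hE, Prod.fst_sum, Finset.sum_apply, Pi.single_apply]
    · simp [hH, hE, Prod.snd_sum]
  have hhalf : ∀ t, halfPoint n t = H + t • U := fun t => by
    rw [hHval]
    ext i <;> simp [halfPoint, hU]
  have hBH : ∀ j, B H (E j) = q (E j) := fun j => by
    rw [hH, map_smul, map_sum, LinearMap.smul_apply, LinearMap.sum_apply,
      Finset.sum_eq_single j (fun i _ hij => horth i j hij) (by simp), hself]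
    simp
  -- Half the difference and half the sum of the equations at the antipodal vertices `H - U ± E j`.
  have hbot : ∀ j, B (H - U) (E j) = q (E j) ∧ q (H - U) + q (E j) = l (H - U) := fun j => by
    have hp : halfPoint n (-1) = H - U := by rw [hhalf]; module
    have h1 := h (halfPoint n (-1) + E j) (Or.inr ⟨j, Or.inl rfl⟩)
    have h2 := h (halfPoint n (-1) - E j) (Or.inr ⟨j, Or.inr rfl⟩)
    rw [hp] at h1 h2
    rw [sub_eq_add_neg (H - U) (E j)] at h2
    rw [hadd, map_add] at h1
    rw [hadd, map_add, QuadraticMap.map_neg, map_neg, map_neg] at h2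
    have h3 := hlE j
    constructor <;> linarith
  have hBU : ∀ j, B U (E j) = 0 := fun j => by
    have h1 := (hbot j).1
    rw [map_sub, LinearMap.sub_apply, hBH] at h1
    linarith
  let i0 : Fin (n - 1) := ⟨0, by omega⟩
  have ha : ∀ j, q (E j) = q (E i0) := fun j => by linarith [(hbot j).2, (hbot i0).2]
  set a := q (E i0) with haa
  have hlH : l H = ((n : ℝ) - 1) * a / 2 := by
    rw [hH, map_smul, map_sum, Finset.sum_congr rfl fun i _ => (hlE i).trans (ha i)]
    simp [hc]; ring
  have hqH : q H = ((n : ℝ) - 1) * a / 4 := by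
    have h1 : B H H = ((n : ℝ) - 1) * a / 2 := by
      conv_lhs => rw [hH, map_smul]
      rw [← hH, map_sum, Finset.sum_congr rfl fun i _ => (hBH i).trans (ha i)]
      simp [hc]; ring
    rw [hself] at h1
    linarith
  have hBHU : B H U = 0 := by
    rw [hcomm, hH, map_smul, map_sum, Finset.sum_congr rfl fun i _ => hBU i]
    simp
  have htop : q H + q U = l H + l U := by
    have h1 := h (halfPoint n 1) (Or.inl (Or.inl rfl))
    rw [hhalf, one_smul, hadd, map_add, hBHU] at h1
    linarith
  have hbot' : q H + q U + a = l H - l U := by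
    have h1 := (hbot i0).2
    rw [sub_eq_add_neg, hadd, QuadraticMap.map_neg, map_neg, hBHU, map_add, map_neg] at h1
    linarith
  -- Adding `htop` and `hbot'` gives `q U = l H - q H - a / 2`; subtracting them gives `l U = -a /
  -- 2`.
  have hqU : q U = a * (((n : ℝ) - 3) / 4) := by linarith
  refine ⟨a, ?_, fun i => (hlE i).trans (ha i), by linarith⟩
  have hBv : ∀ v, 2 * q v = 2 * (a * formQ n v) := fun v => by
    have hBE : ∀ i, B v (E i) = v.1 i * (2 * a) := fun i => by
      rw [space_decomp v, map_add, map_sum, LinearMap.add_apply, LinearMap.sum_apply, map_smul,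
        LinearMap.smul_apply, hBU, Finset.sum_eq_single i, map_smul, LinearMap.smul_apply,
        ← space_decomp v, hself, ha]
      · simp
      · intro j _ hij
        rw [map_smul, LinearMap.smul_apply, horth j i hij, smul_zero]
      · simp
    have hBvU : B v U = v.2 * (2 * (a * (((n : ℝ) - 3) / 4))) := by
      rw [hcomm, space_decomp v, map_add, map_sum, map_smul, hself, hqU,
        Finset.sum_eq_zero, ← space_decomp v]
      · simp
      · intro j _
        rw [map_smul, hBU, smul_zero]
    have hvv : B v v = ∑ i, v.1 i * B v (E i) + v.2 * B v U := by
      have := congrArg (B v) (space_decomp v)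
      simpa only [map_add, map_sum, map_smul, smul_eq_mul] using this
    rw [← hself, formQ_apply, hvv, hBvU]
    simp only [hBE]
    rw [mul_add, mul_add, Finset.mul_sum, Finset.mul_sum]
    congr 1
    · exact Finset.sum_congr rfl fun i _ => by ring
    · ring
  ext v
  rw [smul_apply, smul_eq_mul]
  linarith [hBv v]

/-- The vertex `0` gives `ρ = q c`, so the sphere equation becomes `q v = polar q c v`. The values
of this linear form encode the center. -/
theorem eq_smul_formQ_of_sphere {n : ℕ} (h6 : 6 ≤ n) {q : QuadraticForm ℝ (Space n)}
    {c : Space n} {ρ : ℝ} (h : ∀ v ∈ layers n, q (v - c) = ρ) :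
    ∃ a : ℝ, q = a • formQ n ∧ (∀ i, QuadraticMap.polar q c (Pi.single i 1, 0) = a) ∧
      QuadraticMap.polar q c (0, 1) = -(a / 2) := by
  have h0 := h 0 (zero_mem_layers n)
  rw [zero_sub, QuadraticMap.map_neg] at h0
  exact form_eq_of_eq_linear_on_layers h6 (l := QuadraticMap.polarBilin q c) fun v hv => by
    have := h v hv
    rw [form_sub_eq, QuadraticMap.polar_comm] at this
    change q v = QuadraticMap.polar q c v
    linarith

theorem form_unique {n : ℕ} (h6 : 6 ≤ n) {q : QuadraticForm ℝ (Space n)}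
    {L : Submodule ℤ (Space n)} (h : IsDelaunayIn q L (polytopeP n)) :
    ∃ α : ℝ, 0 < α ∧ q = α • formQ n := by
  obtain ⟨c, r, h⟩ := h
  have hs := h.extremePoints_eq
  rw [extremePoints_polytopeP h6] at hs
  obtain ⟨a, ha, -⟩ := eq_smul_formQ_of_sphere h6 (q := q) (c := c) (ρ := r ^ 2)
    fun v hv => by rw [hs] at hv; exact hv.2
  refine ⟨a, ?_, ha⟩
  have hx : ((0, 1) : Space n) ≠ 0 := fun h => one_ne_zero (congrArg Prod.snd h)
  have h1 := h.1.posDef _ hx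
  have h2 := formQ_posDef h6 _ hx
  rw [ha, smul_apply, smul_eq_mul] at h1
  exact pos_of_mul_pos_left h1 h2.le

theorem polar_formQ {n : ℕ} (u v : Space n) :
    QuadraticMap.polar (formQ n) u v =
      2 * ∑ i, u.1 i * v.1 i + ((n : ℝ) - 3) / 2 * (u.2 * v.2) := by
  have : ∑ i, (u.1 i + v.1 i) ^ 2 =
      ∑ i, u.1 i ^ 2 + ∑ i, v.1 i ^ 2 + 2 * ∑ i, u.1 i * v.1 i := by
    rw [Finset.mul_sum, ← Finset.sum_add_distrib, ← Finset.sum_add_distrib]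
    exact Finset.sum_congr rfl fun i _ => by ring
  simp only [QuadraticMap.polar, formQ_apply, Prod.fst_add, Prod.snd_add, Pi.add_apply, this]
  ring

theorem isDelaunaySphere_iff {n : ℕ} (hn : Even n) (h6 : 6 ≤ n) (c : Space n) (r : ℝ) :
    IsDelaunaySphere (formQ n) (latticeL n) (polytopeP n) c r ↔
      c = halfPoint n (-1 / ((n : ℝ) - 3)) ∧
        r = ((n : ℝ) - 2) / (2 * Real.sqrt ((n : ℝ) - 3)) := by
  have hN : (6 : ℝ) ≤ n := by exact_mod_cast h6
  have hN3 : (n : ℝ) - 3 ≠ 0 := by linarith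
  constructor
  · intro h
    have hs := h.extremePoints_eq
    rw [extremePoints_polytopeP h6] at hs
    have hr : ∀ v ∈ layers n, formQ n (v - c) = r ^ 2 := fun v hv => by
      rw [hs] at hv; exact hv.2
    obtain ⟨a, ha, h1, h2⟩ := eq_smul_formQ_of_sphere h6 hr
    have hx : ((0, 1) : Space n) ≠ 0 := fun h => one_ne_zero (congrArg Prod.snd h)
    have h3 := (formQ_posDef h6 _ hx).ne'
    -- With the scale fixed, the polar values `h1` and `h2` give the coordinates of `c`.
    have ha1 : a = 1 := by
      have h4 := DFunLike.congr_fun ha ((0, 1) : Space n)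
      rw [smul_apply, smul_eq_mul] at h4
      exact (mul_right_cancel₀ h3 (h4.symm.trans (one_mul _).symm))
    subst ha1
    have hc : c = center n := by
      ext i
      · have := h1 i
        rw [polar_formQ] at this
        simp [Pi.single_apply] at this
        simp [center, halfPoint]
        linarith
      · rw [polar_formQ] at h2
        simp at h2
        simp only [center, halfPoint]
        field_simp
        linarith
    have hD := isDelaunaySphere_polytopeP hn h6
    refine ⟨hc, ?_⟩
    have hs' := hD.extremePoints_eq
    rw [extremePoints_polytopeP h6] at hs'
    have h5 := zero_mem_layers n
    rw [hs'] at h5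
    have h6 := hr 0 (zero_mem_layers n)
    rw [hc, h5.2] at h6
    exact ((sq_eq_sq₀ hD.1.radius_nonneg h.1.radius_nonneg).1 h6).symm
  · rintro ⟨rfl, rfl⟩
    exact isDelaunaySphere_polytopeP hn h6

theorem isExtremeDelaunay_polytopeP {n : ℕ} (hn : Even n) (h6 : 6 ≤ n) :
    IsExtremeDelaunay (formQ n) (polytopeP n) :=
  isExtremeDelaunay_of_unique ⟨_, _, _, isDelaunaySphere_polytopeP hn h6⟩
    (by rw [extremePoints_polytopeP h6]; exact zero_mem_layers n) fun _ _ h => form_unique h6 h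

/-! ### Signed permutations and the stabilizer of the apex -/

/-- For a 0/1 vector, `1 - 2 * x i` is `(-1) ^ x i`. This multiplicative form of the parity
condition is the one on which sign changes act transparently. -/
theorem mem_halfCube_iff {m : ℕ} {x : Fin m → ℝ} :
    x ∈ halfCube m ↔ (∀ i, x i = 0 ∨ x i = 1) ∧ ∏ i, (1 - 2 * x i) = 1 := by
  have key : ∀ k : Fin m → ℕ, (∀ i, x i = k i) → (∀ i, k i = 0 ∨ k i = 1) →
      (∏ i, (1 - 2 * x i) = 1 ↔ Even (∑ i, k i)) := by
    intro k hk h01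
    have h1 : ∀ i, 1 - 2 * x i = (-1 : ℝ) ^ k i := fun i => by
      rw [hk]
      rcases h01 i with h | h <;> rw [h] <;> norm_num
    rw [Finset.prod_congr rfl fun i _ => h1 i, Finset.prod_pow_eq_pow_sum,
      neg_one_pow_eq_one_iff_even (by norm_num)]
  constructor
  · rintro ⟨⟨z, hz, he⟩, h01⟩
    have h01' : ∀ i, z i = 0 ∨ z i = 1 := fun i => by
      have := h01 i
      rw [hz] at this
      exact_mod_cast this
    have hnn : ∀ i, ((z i).toNat : ℤ) = z i := fun i =>
      Int.toNat_of_nonneg (by rcases h01' i with h | h <;> omega)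
    refine ⟨h01, (key (fun i => (z i).toNat) (fun i => ?_) fun i => ?_).2 ?_⟩
    · rw [hz]
      exact_mod_cast (hnn i).symm
    · rcases h01' i with h | h <;> simp [h]
    · rw [← Int.even_coe_nat]
      push_cast
      simpa only [Int.ofNat_toNat, hnn] using (by simpa [hnn] using he)
  · rintro ⟨h01, hp⟩
    have : ∀ i, ∃ k : ℕ, x i = k ∧ (k = 0 ∨ k = 1) := fun i => by
      rcases h01 i with h | h
      · exact ⟨0, by simp [h]⟩
      · exact ⟨1, by simp [h]⟩
    choose k hk hk1 using this
    refine ⟨⟨fun i => k i, fun i => by simp [hk], ?_⟩, h01⟩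
    have := (key k hk hk1).1 hp
    change Even (∑ i, (k i : ℤ))
    exact_mod_cast this

theorem mem_isometryGroup_polytopeP {n : ℕ} (h6 : 6 ≤ n) {f : Space n ≃ᵃ[ℝ] Space n} :
    f ∈ isometryGroup (formQ n) (polytopeP n) ↔ IsIsom (formQ n) f ∧ f '' layers n = layers n :=
  mem_isometryGroup_convexHull (formQ_posDef h6) (fun _ hv => layers_sphere h6 hv) f

/-- The points `(1/2, …, 1/2, -1) ± e_j`. -/
noncomputable def bottomPoint (n : ℕ) (j : Fin (n - 1)) (ε : ℤˣ) : Space n :=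
  halfPoint n (-1) + (Pi.single j ((ε : ℤ) : ℝ), 0)

theorem bottomPoint_mem_layers {n : ℕ} (j : Fin (n - 1)) (ε : ℤˣ) :
    bottomPoint n j ε ∈ layers n := by
  refine Or.inr ⟨j, ?_⟩
  rcases Int.units_eq_one_or ε with rfl | rfl
  · left; simp [bottomPoint]
  · right
    ext i
    · simp [bottomPoint, Pi.single_neg]; ring
    · simp [bottomPoint]

/-- The three kinds of vertices of `P_n`. -/
theorem mem_layers_iff {n : ℕ} {v : Space n} :
    v ∈ layers n ↔ v = halfPoint n 1 ∨ (∃ x ∈ halfCube (n - 1), v = (x, 0)) ∨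
      ∃ j ε, v = bottomPoint n j ε := by
  constructor
  · rintro ((rfl | h) | ⟨j, rfl | rfl⟩)
    · exact Or.inl rfl
    · exact Or.inr (Or.inl h)
    · exact Or.inr (Or.inr ⟨j, 1, by simp [bottomPoint]⟩)
    · refine Or.inr (Or.inr ⟨j, -1, ?_⟩)
      ext i
      · simp [bottomPoint, Pi.single_neg]; ring
      · simp [bottomPoint]
  · rintro (rfl | h | ⟨j, ε, rfl⟩)
    · exact Or.inl (Or.inl rfl)
    · exact Or.inl (Or.inr h)
    · exact bottomPoint_mem_layers j ε

@[simp] theorem halfPoint_fst (n : ℕ) (t : ℝ) (i : Fin (n - 1)) : (halfPoint n t).1 i = 1 / 2 := rfl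
@[simp] theorem halfPoint_snd (n : ℕ) (t : ℝ) : (halfPoint n t).2 = t := rfl
@[simp] theorem bottomPoint_snd (n : ℕ) (j : Fin (n - 1)) (ε : ℤˣ) :
    (bottomPoint n j ε).2 = -1 := by simp [bottomPoint]
@[simp] theorem bottomPoint_fst (n : ℕ) (j : Fin (n - 1)) (ε : ℤˣ) (i : Fin (n - 1)) :
    (bottomPoint n j ε).1 i = 1 / 2 + (Pi.single j ((ε : ℤ) : ℝ) : Fin (n - 1) → ℝ) i := by
  simp [bottomPoint]

theorem unit_cast_sq (ε : ℤˣ) : (((ε : ℤ) : ℝ)) ^ 2 = 1 := by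
  rcases Int.units_eq_one_or ε with rfl | rfl <;> simp

/-- The distance of a vertex to the apex is determined by its layer. -/
theorem formQ_sub_apex {n : ℕ} (h6 : 6 ≤ n) {v : Space n} (hv : v ∈ layers n) :
    formQ n (v - halfPoint n 1) = (1 - v.2) * ((n : ℝ) - 2) / 2 := by
  have hc := card_cast h6
  rw [formQ_apply]
  rcases mem_layers_iff.1 hv with rfl | ⟨x, hx, rfl⟩ | ⟨j, ε, rfl⟩
  · simp
  · have h1 : ∀ i, (x i - 1 / 2) ^ 2 = 1 / 4 := fun i => by
      rcases hx.2 i with h | h <;> rw [h] <;> norm_num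
    simp only [Prod.fst_sub, Prod.snd_sub, Pi.sub_apply, halfPoint_fst, halfPoint_snd, h1]
    simp [hc]
    ring
  · simp [Pi.single_apply, ite_pow, unit_cast_sq]
    ring

theorem snd_eq_of_fix_apex {n : ℕ} (h6 : 6 ≤ n) {f : Space n ≃ᵃ[ℝ] Space n}
    (hf : f ∈ isometryGroup (formQ n) (polytopeP n)) (ha : f (halfPoint n 1) = halfPoint n 1)
    {v : Space n} (hv : v ∈ layers n) : (f v).2 = v.2 := by
  rw [mem_isometryGroup_polytopeP h6] at hf
  have hfv : f v ∈ layers n := hf.2 ▸ Set.mem_image_of_mem f hv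
  have h1 := formQ_sub_apex h6 hfv
  have h2 := formQ_sub_apex h6 hv
  have h3 := hf.1 v (halfPoint n 1)
  rw [ha, h1, h2] at h3
  have hN : (6 : ℝ) ≤ n := by exact_mod_cast h6
  have h4 : (n : ℝ) - 2 ≠ 0 := by linarith
  have h5 : (1 - (f v).2) * ((n : ℝ) - 2) = (1 - v.2) * ((n : ℝ) - 2) := by linarith
  have := mul_right_cancel₀ h4 h5
  linarith

theorem exists_bottomPoint {n : ℕ} {v : Space n} (hv : v ∈ layers n) (h : v.2 = -1) :
    ∃ j ε, v = bottomPoint n j ε := by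
  rcases mem_layers_iff.1 hv with rfl | ⟨x, hx, rfl⟩ | h'
  · norm_num at h
  · norm_num at h
  · exact h'

theorem exists_halfCube {n : ℕ} {v : Space n} (hv : v ∈ layers n) (h : v.2 = 0) :
    v.1 ∈ halfCube (n - 1) := by
  rcases mem_layers_iff.1 hv with rfl | ⟨x, hx, rfl⟩ | ⟨j, ε, rfl⟩
  · norm_num at h
  · exact hx
  · norm_num at h

/-- The group `2^{m-1} ⋊ Sym(m)`, where `m = n - 1`. -/
abbrev HalfCubeGroup (n : ℕ) : Type :=
  evenSigns (n - 1) ⋊[permSigns (n - 1)] Equiv.Perm (Fin (n - 1))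

/-- The affine maps permuting the first `n - 1` coordinates and changing evenly many signs, relative
to the point `(1/2, …, 1/2)`. -/
noncomputable def signedPermMap (n : ℕ) : HalfCubeGroup n →* (Space n →ᵃ[ℝ] Space n) where
  toFun g :=
    { toFun := fun p =>
        (fun i => 1 / 2 + ((g.left.1 i : ℤ) : ℝ) * (p.1 (g.right⁻¹ i) - 1 / 2), p.2)
      linear :=
        { toFun := fun p => (fun i => ((g.left.1 i : ℤ) : ℝ) * p.1 (g.right⁻¹ i), p.2)
          map_add' := fun p q => by ext i <;> simp [mul_add]
          map_smul' := fun a p => by ext i <;> simp; ring }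
      map_vadd' := fun p v => by ext i <;> simp; ring }
  map_one' := by ext p i <;> simp
  map_mul' g h := by
    ext p i
    · simp [permSigns]; ring
    · simp

/-- A homomorphism from a group lands in the units, and units among the affine maps are affine
bijections. -/
noncomputable def signedPermEquiv (n : ℕ) : HalfCubeGroup n →* (Space n ≃ᵃ[ℝ] Space n) :=
  (AffineEquiv.equivUnitsAffineMap (k := ℝ) (P₁ := Space n)).symm.toMonoidHom.comp
    (signedPermMap n).toHomUnits

@[simp] theorem signedPermEquiv_fst {n : ℕ} (g : HalfCubeGroup n) (p : Space n) (i : Fin (n - 1)) :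
    (signedPermEquiv n g p).1 i =
      1 / 2 + ((g.left.1 i : ℤ) : ℝ) * (p.1 (g.right⁻¹ i) - 1 / 2) := rfl

@[simp] theorem signedPermEquiv_snd {n : ℕ} (g : HalfCubeGroup n) (p : Space n) :
    (signedPermEquiv n g p).2 = p.2 := rfl

theorem prod_units_cast {m : ℕ} (s : Fin m → ℤˣ) :
    ∏ i, ((s i : ℤ) : ℝ) = ((∏ i, s i : ℤˣ) : ℤ) := by
  push_cast
  rfl

theorem signedPermEquiv_mem_layers {n : ℕ} (g : HalfCubeGroup n) {v : Space n}
    (hv : v ∈ layers n) : signedPermEquiv n g v ∈ layers n := by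
  rcases mem_layers_iff.1 hv with rfl | ⟨x, hx, rfl⟩ | ⟨j, ε, rfl⟩
  · refine mem_layers_iff.2 (Or.inl ?_)
    ext i <;> simp
  · refine mem_layers_iff.2 (Or.inr (Or.inl ⟨(signedPermEquiv n g (x, 0)).1, ?_, rfl⟩))
    rw [mem_halfCube_iff] at hx ⊢
    refine ⟨fun i => ?_, ?_⟩
    · rw [signedPermEquiv_fst]
      rcases Int.units_eq_one_or (g.left.1 i) with h | h <;>
        rcases hx.1 (g.right⁻¹ i) with h' | h' <;> simp only [h, h'] <;> norm_num
    · have h1 : ∀ i, 1 - 2 * (signedPermEquiv n g (x, 0)).1 i =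
          ((g.left.1 i : ℤ) : ℝ) * (1 - 2 * x (g.right⁻¹ i)) := fun i => by
        rw [signedPermEquiv_fst]; ring
      rw [Finset.prod_congr rfl fun i _ => h1 i, Finset.prod_mul_distrib, prod_units_cast,
        Equiv.prod_comp g.right⁻¹ fun i => 1 - 2 * x i, hx.2,
        show ∏ i, g.left.1 i = 1 from g.left.2]
      simp
  · refine mem_layers_iff.2 (Or.inr (Or.inr ⟨g.right j, g.left.1 (g.right j) * ε, ?_⟩))
    ext i
    · by_cases h : i = g.right j
      · subst h; simp
      · have h' : g.right⁻¹ i ≠ j := fun h' => h (by rw [← h']; simp)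
        rw [signedPermEquiv_fst, bottomPoint_fst, bottomPoint_fst, Pi.single_eq_of_ne h',
          Pi.single_eq_of_ne h]
        ring
    · simp

theorem signedPermEquiv_mem_isometryGroup {n : ℕ} (h6 : 6 ≤ n) (g : HalfCubeGroup n) :
    signedPermEquiv n g ∈ isometryGroup (formQ n) (polytopeP n) := by
  rw [mem_isometryGroup_polytopeP h6]
  refine ⟨fun x y => ?_, Set.Subset.antisymm ?_ fun v hv => ?_⟩
  · rw [formQ_apply, formQ_apply]
    congr 1
    rw [← Equiv.sum_comp g.right⁻¹ fun i => (x - y).1 i ^ 2]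
    refine Finset.sum_congr rfl fun i _ => ?_
    have h1 := unit_cast_sq (g.left.1 i)
    simp only [Prod.fst_sub, Pi.sub_apply, signedPermEquiv_fst]
    linear_combination (x.1 (g.right⁻¹ i) - y.1 (g.right⁻¹ i)) ^ 2 * h1
  · rintro _ ⟨v, hv, rfl⟩
    exact signedPermEquiv_mem_layers g hv
  · refine ⟨_, signedPermEquiv_mem_layers g⁻¹ hv, ?_⟩
    rw [map_inv]
    exact (signedPermEquiv n g).apply_symm_apply v

theorem signedPermEquiv_injective (n : ℕ) : Function.Injective (signedPermEquiv n) := by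
  rw [injective_iff_map_eq_one]
  intro g hg
  have h1 : ∀ i, g.right⁻¹ i = i ∧ g.left.1 i = 1 := fun i => by
    -- This vertex has `3/2` as its `i`-th coordinate and `1/2` in the other first coordinates, so
    -- it detects both the permutation and the sign at `i`.
    have h2 := congrArg (fun p : Space n => p.1 i) (DFunLike.congr_fun hg (bottomPoint n i 1))
    simp only [signedPermEquiv_fst, AffineEquiv.one_def, AffineEquiv.refl_apply,
      bottomPoint_fst] at h2
    have h3 : g.right⁻¹ i = i := by
      by_contra h
      rw [Pi.single_eq_of_ne h] at h2
      simp at h2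
    refine ⟨h3, ?_⟩
    rcases Int.units_eq_one_or (g.left.1 i) with h | h
    · exact h
    · rw [h3, h] at h2
      norm_num at h2
  have hσ : g.right = 1 := by
    rw [← inv_eq_one]
    exact Equiv.ext fun i => (h1 i).1
  have hs : g.left = 1 := Subtype.ext (funext fun i => (h1 i).2)
  exact SemidirectProduct.ext hs hσ

theorem prod_units_eq_one {m : ℕ} {s : Fin m → ℤˣ} (h : ∏ i, ((s i : ℤ) : ℝ) = 1) :
    ∏ i, s i = 1 := by
  rw [prod_units_cast] at h
  exact Units.ext (Int.cast_injective (h.trans Int.cast_one.symm))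

/-- The value is `4` exactly for antipodes and `2` across different axes, so isometries preserve
antipodal pairs of the bottom cross-polytope. -/
theorem formQ_bottomPoint_sub {n : ℕ} (j k : Fin (n - 1)) (ε δ : ℤˣ) :
    formQ n (bottomPoint n j ε - bottomPoint n k δ) =
      2 - 2 * (Pi.single j ((ε : ℤ) : ℝ) : Fin (n - 1) → ℝ) k * ((δ : ℤ) : ℝ) := by
  rw [formQ_apply]
  have h1 : ∀ i, ((bottomPoint n j ε - bottomPoint n k δ).1 i) ^ 2 =
      (Pi.single j 1 : Fin (n - 1) → ℝ) i + (Pi.single k 1 : Fin (n - 1) → ℝ) i -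
        2 * (Pi.single j ((ε : ℤ) : ℝ) : Fin (n - 1) → ℝ) i *
          (Pi.single k ((δ : ℤ) : ℝ) : Fin (n - 1) → ℝ) i := fun i => by
    simp only [Prod.fst_sub, Pi.sub_apply, bottomPoint_fst, Pi.single_apply]
    have hε := unit_cast_sq ε
    have hδ := unit_cast_sq δ
    split_ifs <;> linarith
  simp only [h1, Finset.sum_sub_distrib, Finset.sum_add_distrib]
  simp [Pi.single_apply]
  norm_num

/-- An isometry of `P_n` that fixes the apex is a signed permutation of the coordinates. -/
theorem exists_signedPermEquiv_of_fix_apex {n : ℕ} (h6 : 6 ≤ n) {f : Space n ≃ᵃ[ℝ] Space n}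
    (hf : f ∈ isometryGroup (formQ n) (polytopeP n)) (ha : f (halfPoint n 1) = halfPoint n 1) :
    ∃ g, signedPermEquiv n g = f := by
  have hlay := ((mem_isometryGroup_polytopeP h6).1 hf).2
  have hmem : ∀ v ∈ layers n, f v ∈ layers n := fun v hv => hlay ▸ Set.mem_image_of_mem f hv
  have hsnd := fun v (hv : v ∈ layers n) => snd_eq_of_fix_apex h6 hf ha hv
  have hb : ∀ j ε, ∃ k δ, f (bottomPoint n j ε) = bottomPoint n k δ := fun j ε =>
    exists_bottomPoint (hmem _ (bottomPoint_mem_layers j ε))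
      (by rw [hsnd _ (bottomPoint_mem_layers j ε), bottomPoint_snd])
  have hb2 : ∀ j, ∃ k ε, f (bottomPoint n j 1) = bottomPoint n k ε ∧
      f (bottomPoint n j (-1)) = bottomPoint n k (-ε) := fun j => by
    obtain ⟨k, ε, h1⟩ := hb j 1
    obtain ⟨k', ε', h2⟩ := hb j (-1)
    have h3 := ((mem_isometryGroup_polytopeP h6).1 hf).1 (bottomPoint n j 1) (bottomPoint n j (-1))
    rw [h1, h2, formQ_bottomPoint_sub, formQ_bottomPoint_sub] at h3
    by_cases hk : k' = k
    · subst hk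
      refine ⟨k', ε, h1, ?_⟩
      rw [h2]
      congr 1
      rcases Int.units_eq_one_or ε with rfl | rfl <;>
        rcases Int.units_eq_one_or ε' with rfl | rfl <;> simp at h3 ⊢ <;> norm_num at h3
    · rw [Pi.single_eq_of_ne hk] at h3
      norm_num at h3
  choose σ ε h1 h2 using hb2
  set w := halfPoint n (-1) with hw
  have hAE : ∀ j, f.linear (Pi.single j 1, 0) = (Pi.single (σ j) ((ε j : ℤ) : ℝ), 0) := fun j => by
    have h3 : bottomPoint n j 1 - bottomPoint n j (-1) =
        (2 : ℝ) • ((Pi.single j 1, 0) : Space n) := by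
      simp [bottomPoint, Pi.single_neg, two_smul]
    have h4 : bottomPoint n (σ j) (ε j) - bottomPoint n (σ j) (-ε j) =
        (2 : ℝ) • ((Pi.single (σ j) ((ε j : ℤ) : ℝ), 0) : Space n) := by
      simp [bottomPoint, Pi.single_neg, two_smul]
    have h5 := affineEquiv_linear_sub f (bottomPoint n j 1) (bottomPoint n j (-1))
    rw [h1, h2, h3, h4, map_smul] at h5
    exact smul_right_injective _ (two_ne_zero : (2 : ℝ) ≠ 0) h5
  -- `w` is the midpoint of antipodal bottom vertices; with the apex it pins down the last axis.
  have hfw : f w = w := by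
    let j : Fin (n - 1) := ⟨0, by omega⟩
    have h5 := affineEquiv_linear_sub f (bottomPoint n j 1) w
    have h6 : bottomPoint n j 1 - w = (Pi.single j 1, 0) := by simp [bottomPoint, hw]
    rw [h6, hAE, h1, eq_sub_iff_add_eq, add_comm, ← eq_sub_iff_add_eq] at h5
    rw [h5]
    simp [bottomPoint, hw]
  have hAU : f.linear (0, 1) = (0, 1) := by
    have h3 : halfPoint n 1 - w = (2 : ℝ) • ((0, 1) : Space n) := by
      ext i <;> simp [hw]; norm_num
    have h5 := affineEquiv_linear_sub f (halfPoint n 1) w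
    rw [ha, hfw, h3, map_smul] at h5
    exact smul_right_injective _ (two_ne_zero : (2 : ℝ) ≠ 0) h5
  have hσ : Function.Injective σ := fun j k hjk => by
    by_contra hne
    have h3 : f.linear (((ε j : ℤ) : ℝ) • ((Pi.single j 1, 0) : Space n)) =
        f.linear (((ε k : ℤ) : ℝ) • ((Pi.single k 1, 0) : Space n)) := by
      rw [map_smul, map_smul, hAE, hAE, hjk]
      have hj := unit_cast_sq (ε j)
      have hk := unit_cast_sq (ε k)
      ext i
      · by_cases hi : i = σ k
        · subst hi; simp; linarith
        · simp [hi]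
      · simp
    have h4 := congrArg (fun p : Space n => p.1 j) (f.linear.injective h3)
    simp [hne] at h4
  let τ : Equiv.Perm (Fin (n - 1)) := Equiv.ofBijective σ (Finite.injective_iff_bijective.1 hσ)
  have hf1 : ∀ p i, (f p).1 i =
      1 / 2 + ((ε (τ⁻¹ i) : ℤ) : ℝ) * (p.1 (τ⁻¹ i) - 1 / 2) ∧ (f p).2 = p.2 := fun p i => by
    have h3 := affineEquiv_linear_sub f p w
    rw [hfw, space_decomp (p - w), map_add, map_sum, map_smul, hAU] at h3
    simp only [map_smul, hAE] at h3
    rw [eq_sub_iff_add_eq] at h3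
    have hi : σ (τ⁻¹ i) = i := τ.apply_symm_apply i
    constructor
    · rw [← h3]
      simp only [Prod.fst_add, Prod.fst_sum, Pi.add_apply, Finset.sum_apply, Prod.smul_fst,
        Pi.smul_apply, smul_eq_mul, Prod.fst_sub, Pi.sub_apply, hw, halfPoint_fst, Pi.zero_apply]
      rw [Finset.sum_eq_single (τ⁻¹ i)]
      · rw [hi, Pi.single_eq_same]; ring
      · intro k _ hk
        rw [Pi.single_eq_of_ne, mul_zero]
        intro h
        exact hk (hσ (h.symm.trans hi.symm))
      · simp
    · rw [← h3]
      simp [hw, Prod.snd_sum]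
  -- The image of the origin is a half-cube vertex, whose parity is the product of the signs.
  have hprod : ∏ i, ε (τ⁻¹ i) = 1 := by
    have h3 := exists_halfCube (hmem 0 (zero_mem_layers n)) (by rw [hsnd _ (zero_mem_layers n)]; rfl)
    have h4 := (mem_halfCube_iff.1 h3).2
    have h5 : ∀ i, 1 - 2 * (f 0).1 i = ((ε (τ⁻¹ i) : ℤ) : ℝ) := fun i => by
      rw [(hf1 0 i).1]
      simp only [Prod.fst_zero, Pi.zero_apply]
      ring
    rw [Finset.prod_congr rfl fun i _ => h5 i] at h4
    exact prod_units_eq_one h4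
  refine ⟨⟨⟨fun i => ε (τ⁻¹ i), hprod⟩, τ⟩, ?_⟩
  ext p i
  · rw [signedPermEquiv_fst, (hf1 p i).1]
  · rw [signedPermEquiv_snd, (hf1 p ⟨0, by omega⟩).2]

/-- The sign changes `1 - 2 * x i` suffice, without permuting. -/
theorem exists_signedPermEquiv_zero {n : ℕ} {x : Fin (n - 1) → ℝ} (hx : x ∈ halfCube (n - 1)) :
    ∃ g, signedPermEquiv n g 0 = (x, 0) := by
  rw [mem_halfCube_iff] at hx
  have h : ∀ i, ∃ s : ℤˣ, 1 - 2 * x i = ((s : ℤ) : ℝ) := fun i => by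
    rcases hx.1 i with h | h
    · exact ⟨1, by simp [h]⟩
    · exact ⟨-1, by rw [h]; norm_num⟩
  choose s hs using h
  have hp : ∏ i, s i = 1 := by
    have h4 := hx.2
    rw [Finset.prod_congr rfl fun i _ => hs i] at h4
    exact prod_units_eq_one h4
  refine ⟨⟨⟨s, hp⟩, 1⟩, ?_⟩
  ext i
  · rw [signedPermEquiv_fst]
    simp only [Prod.fst_zero, Pi.zero_apply]
    linarith [hs i]
  · rfl

theorem exists_signedPermEquiv_bottomPoint {n : ℕ} (h6 : 6 ≤ n) (j k : Fin (n - 1)) (ε δ : ℤˣ) :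
    ∃ g, signedPermEquiv n g (bottomPoint n j ε) = bottomPoint n k δ := by
  obtain ⟨o, ho⟩ := exists_notMem_of_card_lt {k} (by simp; omega)
  rw [Finset.mem_singleton] at ho
  -- The sign is repeated at a spare coordinate `o`, where the target vertex is centered, to keep
  -- the number of changes even.
  have hp : ∏ i, (fun i => if i = k ∨ i = o then δ * ε else 1 : Fin (n - 1) → ℤˣ) i = 1 := by
    rw [Finset.prod_eq_mul k o (Ne.symm ho) (by simp +contextual) (by simp) (by simp)]
    simp
  refine ⟨⟨⟨_, hp⟩, Equiv.swap j k⟩, ?_⟩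
  ext i
  · rw [signedPermEquiv_fst, bottomPoint_fst, bottomPoint_fst]
    by_cases hi : i = k
    · subst hi
      have := unit_cast_sq ε
      simp
      linear_combination ((δ : ℤ) : ℝ) * this
    · have h' : (Equiv.swap j k)⁻¹ i ≠ j := by
        rw [Equiv.swap_inv]
        intro h
        exact hi (by rw [← Equiv.swap_apply_self j k i, h, Equiv.swap_apply_left])
      rw [Pi.single_eq_of_ne h', Pi.single_eq_of_ne hi]
      ring
  · simp

/-- The embedding of `2^{n-2} ⋊ Sym(n-1)` into the isometry group of `P_n`. -/
noncomputable def signedPermIsometry (n : ℕ) (h6 : 6 ≤ n) :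
    HalfCubeGroup n →* isometryGroup (formQ n) (polytopeP n) :=
  (signedPermEquiv n).codRestrict _ (signedPermEquiv_mem_isometryGroup h6)

theorem signedPermIsometry_injective {n : ℕ} (h6 : 6 ≤ n) :
    Function.Injective (signedPermIsometry n h6) := fun _ _ h =>
  signedPermEquiv_injective n (congrArg Subtype.val h)

theorem signedPermEquiv_apex {n : ℕ} (g : HalfCubeGroup n) :
    signedPermEquiv n g (halfPoint n 1) = halfPoint n 1 := by
  ext i <;> simp

/-! ### The case `n > 6` -/

/-- Up to symmetry a half-cube vertex is `0`, with neighbour `e_i + e_j`; a bottom vertex has one on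
another axis. From the apex only `0`, `(n-2)/2` and `n-2` occur, none equal to `2` when `n > 6`. -/
theorem exists_formQ_sub_eq_two {n : ℕ} (h6 : 6 ≤ n) {v : Space n} (hv : v ∈ layers n)
    (hne : v ≠ halfPoint n 1) : ∃ w ∈ layers n, formQ n (v - w) = 2 := by
  rcases mem_layers_iff.1 hv with rfl | ⟨x, hx, rfl⟩ | ⟨j, ε, rfl⟩
  · exact absurd rfl hne
  · obtain ⟨g, hg⟩ := exists_signedPermEquiv_zero hx
    have hij : (⟨0, by omega⟩ : Fin (n - 1)) ≠ ⟨1, by omega⟩ := by simp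
    refine ⟨_, signedPermEquiv_mem_layers g (pair_mem_layers hij), ?_⟩
    rw [← hg, (signedPermEquiv_mem_isometryGroup h6 g).1, zero_sub, QuadraticMap.map_neg,
      formQ_apply]
    simp [Pi.single_apply, add_sq, Finset.sum_add_distrib]
    norm_num
  · obtain ⟨o, ho⟩ := exists_notMem_of_card_lt {j} (by simp; omega)
    rw [Finset.mem_singleton] at ho
    refine ⟨_, bottomPoint_mem_layers o 1, ?_⟩
    rw [formQ_bottomPoint_sub, Pi.single_eq_of_ne ho]
    ring

theorem formQ_apex_sub_ne_two {n : ℕ} (h6 : 6 < n) {w : Space n} (hw : w ∈ layers n) :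
    formQ n (w - halfPoint n 1) ≠ 2 := by
  have hN : (6 : ℝ) < n := by exact_mod_cast h6
  rw [formQ_sub_apex h6.le hw]
  intro h
  rcases mem_layers_iff.1 hw with rfl | ⟨x, hx, rfl⟩ | ⟨j, ε, rfl⟩
  · norm_num at h
  · simp only at h; linarith
  · rw [bottomPoint_snd] at h; linarith

theorem isometry_fix_apex {n : ℕ} (h6 : 6 < n) {f : Space n ≃ᵃ[ℝ] Space n}
    (hf : f ∈ isometryGroup (formQ n) (polytopeP n)) : f (halfPoint n 1) = halfPoint n 1 := by
  rw [mem_isometryGroup_polytopeP h6.le] at hf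
  by_contra hne
  have ha : halfPoint n 1 ∈ layers n := Or.inl (Or.inl rfl)
  obtain ⟨w, hw, h2⟩ := exists_formQ_sub_eq_two h6.le
    (hf.2 ▸ Set.mem_image_of_mem f ha : f (halfPoint n 1) ∈ layers n) hne
  rw [← hf.2] at hw
  obtain ⟨u, hu, rfl⟩ := hw
  rw [hf.1, form_sub_comm] at h2
  exact formQ_apex_sub_ne_two h6 hu h2

theorem nonempty_isometryGroup_mulEquiv {n : ℕ} (h6 : 6 < n) :
    Nonempty (isometryGroup (formQ n) (polytopeP n) ≃* HalfCubeGroup n) := by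
  refine ⟨(MulEquiv.ofBijective (signedPermIsometry n h6.le)
    ⟨signedPermIsometry_injective h6.le, fun f => ?_⟩).symm⟩
  obtain ⟨g, hg⟩ := exists_signedPermEquiv_of_fix_apex h6.le f.2 (isometry_fix_apex h6 f.2)
  exact ⟨g, Subtype.ext hg⟩

section Orbits

variable {V : Type*} [NormedAddCommGroup V] [NormedSpace ℝ V]

theorem vertexOrbit_eq {q : QuadraticForm ℝ V} {P : Set V} {f : V ≃ᵃ[ℝ] V}
    (hf : f ∈ isometryGroup q P) (v : V) : vertexOrbit q P (f v) = vertexOrbit q P v := by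
  ext w
  constructor
  · rintro ⟨g, hg, rfl⟩
    exact ⟨g * f, mul_mem hg hf, rfl⟩
  · rintro ⟨g, hg, rfl⟩
    refine ⟨g * f⁻¹, mul_mem hg (inv_mem hf), ?_⟩
    exact congrArg g (f.symm_apply_apply v)

theorem mem_vertexOrbit_self (q : QuadraticForm ℝ V) (P : Set V) (v : V) :
    v ∈ vertexOrbit q P v := ⟨1, one_mem _, rfl⟩

end Orbits

/-- The height is invariant because the apex is fixed, and signed permutations are transitive on
each layer. -/
theorem ncard_vertexOrbits {n : ℕ} (h6 : 6 < n) :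
    (vertexOrbits (formQ n) (polytopeP n)).ncard = 3 := by
  have hne : ∀ v ∈ layers n, ∀ w ∈ layers n, v.2 ≠ w.2 →
      vertexOrbit (formQ n) (polytopeP n) v ≠ vertexOrbit (formQ n) (polytopeP n) w := by
    intro v hv w hw hvw h
    have h1 := mem_vertexOrbit_self (formQ n) (polytopeP n) v
    rw [h] at h1
    obtain ⟨f, hf, rfl⟩ := h1
    exact hvw (snd_eq_of_fix_apex h6.le hf (isometry_fix_apex h6 hf) hw)
  let j : Fin (n - 1) := ⟨0, by omega⟩
  have ha : halfPoint n 1 ∈ layers n := Or.inl (Or.inl rfl)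
  have hz := zero_mem_layers n
  have hb := bottomPoint_mem_layers (n := n) j 1
  rw [Set.ncard_eq_three]
  refine ⟨_, _, _, hne _ ha 0 hz (by simp), hne _ ha _ hb (by simp; norm_num),
    hne 0 hz _ hb (by simp), ?_⟩
  rw [vertexOrbits, vertices, extremePoints_polytopeP h6.le]
  refine Set.Subset.antisymm ?_ ?_
  · rintro _ ⟨v, hv, rfl⟩
    simp only [Set.mem_insert_iff, Set.mem_singleton_iff]
    rcases mem_layers_iff.1 hv with rfl | ⟨x, hx, rfl⟩ | ⟨k, ε, rfl⟩
    · exact Or.inl rfl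
    · obtain ⟨g, hg⟩ := exists_signedPermEquiv_zero hx
      rw [← hg]
      exact Or.inr (Or.inl (vertexOrbit_eq (signedPermEquiv_mem_isometryGroup h6.le g) 0))
    · obtain ⟨g, hg⟩ := exists_signedPermEquiv_bottomPoint h6.le j k 1 ε
      rw [← hg]
      exact Or.inr (Or.inr (vertexOrbit_eq (signedPermEquiv_mem_isometryGroup h6.le g) _))
  · rintro _ (rfl | rfl | rfl)
    · exact ⟨_, ha, rfl⟩
    · exact ⟨_, hz, rfl⟩
    · exact ⟨_, hb, rfl⟩

/-! ### The case `n = 6` -/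

/-- The functional `v ↦ ⟨v, (1/2, …, 1/2, 1)⟩` for the form `q_6`. -/
noncomputable def apexFunctional : Space 6 →ₗ[ℝ] ℝ where
  toFun v := (∑ i, v.1 i) / 2 + 3 / 4 * v.2
  map_add' u v := by simp [Finset.sum_add_distrib]; ring
  map_smul' a v := by simp [← Finset.mul_sum]; ring

theorem apexFunctional_apply (v : Space 6) :
    apexFunctional v = (∑ i, v.1 i) / 2 + 3 / 4 * v.2 := rfl

theorem apexFunctional_apex : apexFunctional (halfPoint 6 1) = 2 := by
  rw [apexFunctional_apply]
  simp
  norm_num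

/-- The reflection that fixes the center of the empty sphere and exchanges the apex and the
origin. -/
noncomputable def apexReflection : Space 6 ≃ᵃ[ℝ] Space 6 :=
  (Module.reflection apexFunctional_apex).toAffineEquiv.trans
    (AffineEquiv.constVAdd ℝ (Space 6) (halfPoint 6 1))

theorem apexReflection_apply (v : Space 6) :
    apexReflection v = halfPoint 6 1 + (v - apexFunctional v • halfPoint 6 1) := rfl

theorem apexReflection_involutive (v : Space 6) : apexReflection (apexReflection v) = v := by
  simp only [apexReflection_apply, map_add, map_sub, map_smul, apexFunctional_apex, smul_eq_mul]
  module

theorem isIsom_apexReflection : IsIsom (formQ 6) apexReflection := by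
  intro x y
  have h1 : apexReflection x - apexReflection y =
      (x - y) - apexFunctional (x - y) • halfPoint 6 1 := by
    simp only [apexReflection_apply, map_sub]
    module
  have h2 : formQ 6 (halfPoint 6 1) = 2 := by
    rw [formQ_apply]; simp; norm_num
  have h3 : QuadraticMap.polar (formQ 6) (x - y) (halfPoint 6 1) = 2 * apexFunctional (x - y) := by
    rw [polar_formQ, apexFunctional_apply]
    simp only [halfPoint_fst, halfPoint_snd, ← Finset.sum_mul]
    push_cast
    ring
  rw [h1, form_sub_eq, QuadraticMap.polar_smul_right, QuadraticMap.map_smul, h2, h3]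
  simp only [smul_eq_mul]
  ring

/-- The functional is integral on `L_6`, so the map preserves the lattice; it takes the value `1` at
the center, which is therefore fixed. Lattice points on the sphere go to lattice points on the
sphere. -/
theorem apexReflection_mem_layers {v : Space 6} (hv : v ∈ layers 6) :
    apexReflection v ∈ layers 6 := by
  have heven : Even 6 := by decide
  have hL := layers_subset_latticeL heven le_rfl hv
  have hint : ∃ k : ℤ, apexFunctional v = k := by
    obtain ⟨k, z, ⟨t, ht⟩, rfl⟩ := mem_latticeL.1 hL
    refine ⟨t + 2 * k, ?_⟩
    have ht' : ∑ i, (z i : ℝ) = t + t := by exact_mod_cast ht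
    rw [apexFunctional_apply]
    simp only [Finset.sum_add_distrib, ht']
    simp
    ring
  have hc : apexReflection (center 6) = center 6 := by
    have : apexFunctional (center 6) = 1 := by
      rw [apexFunctional_apply]
      simp [center]
      norm_num
    rw [apexReflection_apply, this]
    module
  obtain ⟨k, hk⟩ := hint
  have ha : halfPoint 6 1 ∈ latticeL 6 := Submodule.subset_span (Or.inr rfl)
  refine (latticeL_sphere heven le_rfl ?_).2 ?_
  · rw [apexReflection_apply, hk, Int.cast_smul_eq_zsmul]
    exact add_mem ha (sub_mem hL ((latticeL 6).smul_mem k ha))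
  · rw [← hc, isIsom_apexReflection, layers_sphere le_rfl hv]

theorem apexReflection_mem_isometryGroup :
    apexReflection ∈ isometryGroup (formQ 6) (polytopeP 6) := by
  rw [mem_isometryGroup_polytopeP le_rfl]
  refine ⟨isIsom_apexReflection, Set.Subset.antisymm ?_ fun v hv => ?_⟩
  · rintro _ ⟨v, hv, rfl⟩
    exact apexReflection_mem_layers hv
  · exact ⟨_, apexReflection_mem_layers hv, apexReflection_involutive v⟩

theorem exists_isometry_apex_eq {v : Space 6} (hv : v ∈ layers 6) :
    ∃ f ∈ isometryGroup (formQ 6) (polytopeP 6), f (halfPoint 6 1) = v := by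
  have hR := apexReflection_mem_isometryGroup
  have hR0 : apexReflection (halfPoint 6 1) = 0 := by
    rw [apexReflection_apply, apexFunctional_apex]; module
  have hhalf : ∀ x ∈ halfCube (6 - 1), ∃ f ∈ isometryGroup (formQ 6) (polytopeP 6),
      f (halfPoint 6 1) = (x, 0) := fun x hx => by
    obtain ⟨g, hg⟩ := exists_signedPermEquiv_zero hx
    refine ⟨_, mul_mem (signedPermEquiv_mem_isometryGroup le_rfl g) hR, ?_⟩
    rw [← hg, ← hR0]
    rfl
  rcases mem_layers_iff.1 hv with rfl | ⟨x, hx, rfl⟩ | ⟨k, ε, rfl⟩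
  · exact ⟨1, one_mem _, rfl⟩
  · exact hhalf x hx
  · let j : Fin (6 - 1) := ⟨0, by omega⟩
    -- A half-cube vertex with functional value `2`; its image is `x` minus the apex, at height
    -- `-1`.
    let x : Fin (6 - 1) → ℝ := 1 - Pi.single j 1
    have hx : x ∈ halfCube (6 - 1) := by
      refine ⟨⟨1 - Pi.single j 1, fun i => ?_, ?_⟩, fun i => ?_⟩
      · by_cases h : i = j <;> simp [x, h]
      · simp [Finset.sum_sub_distrib]; decide
      · by_cases h : i = j <;> simp [x, h]
    have hxb : apexReflection (x, 0) = bottomPoint 6 j (-1) := by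
      have : apexFunctional (x, 0) = 2 := by
        rw [apexFunctional_apply]
        simp [x, Finset.sum_sub_distrib]
        norm_num
      rw [apexReflection_apply, this]
      ext i
      · simp [x, Pi.single_neg]
      · simp; norm_num
    obtain ⟨f, hf, hfx⟩ := hhalf x hx
    obtain ⟨g, hg⟩ := exists_signedPermEquiv_bottomPoint le_rfl j k (-1) ε
    refine ⟨_, mul_mem (signedPermEquiv_mem_isometryGroup le_rfl g) (mul_mem hR hf), ?_⟩
    rw [← hg, ← hxb, ← hfx]
    rfl

theorem isometryGroup_transitive {v w : Space 6} (hv : v ∈ layers 6) (hw : w ∈ layers 6) :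
    ∃ f ∈ isometryGroup (formQ 6) (polytopeP 6), f v = w := by
  obtain ⟨f, hf, rfl⟩ := exists_isometry_apex_eq hv
  obtain ⟨g, hg, rfl⟩ := exists_isometry_apex_eq hw
  exact ⟨g * f⁻¹, mul_mem hg (inv_mem hf), congrArg g (f.symm_apply_apply _)⟩

theorem card_evenSigns_five : Nat.card (evenSigns 5) = 16 := by
  have : Nat.card (evenSigns 5) = Fintype.card {s : Fin 5 → ℤˣ // ∏ i, s i = 1} :=
    Nat.card_eq_fintype_card (α := {s : Fin 5 → ℤˣ // ∏ i, s i = 1})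
  rw [this]
  decide

/-- `27 = 1 + 16 + 10`, the half-cube being indexed by even sign changes of the origin. -/
theorem ncard_layers_six : (layers 6).ncard = 27 := by
  let F : Unit ⊕ evenSigns 5 ⊕ (Fin 5 × ℤˣ) → Space 6 := Sum.elim (fun _ => halfPoint 6 1)
    (Sum.elim (fun s => signedPermEquiv 6 ⟨s, 1⟩ 0) fun p => bottomPoint 6 p.1 p.2)
  have hF : Set.range F = layers 6 := by
    refine Set.Subset.antisymm ?_ fun v hv => ?_
    · rintro _ ⟨_ | s | ⟨j, ε⟩, rfl⟩
      · exact Or.inl (Or.inl rfl)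
      · exact signedPermEquiv_mem_layers _ (zero_mem_layers 6)
      · exact bottomPoint_mem_layers (n := 6) j ε
    · rcases mem_layers_iff.1 hv with rfl | ⟨x, hx, rfl⟩ | ⟨k, ε, rfl⟩
      · exact ⟨Sum.inl (), rfl⟩
      · obtain ⟨g, hg⟩ := exists_signedPermEquiv_zero hx
        refine ⟨Sum.inr (Sum.inl g.left), ?_⟩
        rw [← hg]
        rfl
      · exact ⟨Sum.inr (Sum.inr (k, ε)), rfl⟩
  have hunit : ∀ a b : ℤˣ, ((a : ℤ) : ℝ) = ((b : ℤ) : ℝ) → a = b := fun a b h =>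
    Units.ext (Int.cast_injective h)
  have hinj : Function.Injective F := by
    refine Function.Injective.sumElim (fun _ _ _ => rfl) (Function.Injective.sumElim ?_ ?_ ?_) ?_
    · intro s t h
      refine Subtype.ext (funext fun i => hunit _ _ ?_)
      have h1 := congrArg (fun p : Space 6 => p.1 i) h
      simp only [signedPermEquiv_fst, Prod.fst_zero, Pi.zero_apply] at h1
      linarith
    · rintro ⟨j, ε⟩ ⟨k, δ⟩ h
      have h1 := congrArg (fun p : Space 6 => p.1 j) h
      simp only [bottomPoint_fst, Pi.single_eq_same] at h1
      have hjk : j = k := by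
        by_contra hne
        rw [Pi.single_eq_of_ne hne] at h1
        have := unit_cast_sq ε
        have h2 : ((ε : ℤ) : ℝ) = 0 := by linarith
        rw [h2] at this
        norm_num at this
      subst hjk
      rw [Pi.single_eq_same] at h1
      exact Prod.ext rfl (hunit _ _ (by linarith))
    · rintro s ⟨j, ε⟩ h
      have h1 : (signedPermEquiv 6 ⟨s, 1⟩ 0).2 = (bottomPoint 6 j ε).2 := congrArg Prod.snd h
      rw [signedPermEquiv_snd, bottomPoint_snd] at h1
      norm_num at h1
    · rintro _ (s | ⟨j, ε⟩) h
      · have h1 : (halfPoint 6 1).2 = (signedPermEquiv 6 ⟨s, 1⟩ 0).2 := congrArg Prod.snd h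
        rw [signedPermEquiv_snd, halfPoint_snd] at h1
        norm_num at h1
      · have h1 : (halfPoint 6 1).2 = (bottomPoint 6 j ε).2 := congrArg Prod.snd h
        rw [bottomPoint_snd, halfPoint_snd] at h1
        norm_num at h1
  rw [← hF, ← Nat.card_coe_set_eq, Nat.card_range_of_injective hinj, Nat.card_sum, Nat.card_sum,
    Nat.card_prod, card_evenSigns_five]
  simp [Fintype.card_units_int]

theorem card_isometryGroup_six :
    Nat.card (isometryGroup (formQ 6) (polytopeP 6)) = 51840 := by
  let G := isometryGroup (formQ 6) (polytopeP 6)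
  let _ : MulAction G (Space 6) :=
    { smul := fun f v => f.1 v
      one_smul := fun _ => rfl
      mul_smul := fun _ _ _ => rfl }
  have horb : MulAction.orbit G (halfPoint 6 1) = layers 6 := by
    ext v
    constructor
    · rintro ⟨f, rfl⟩
      have h1 := ((mem_isometryGroup_polytopeP le_rfl).1 f.2).2
      rw [← h1]
      exact ⟨_, Or.inl (Or.inl rfl), rfl⟩
    · intro hv
      obtain ⟨f, hf, hfv⟩ := exists_isometry_apex_eq hv
      exact ⟨⟨f, hf⟩, hfv⟩
  -- The stabilizer is the whole signed permutation group, of order `16 * 120`; orbit–stabilizer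
  -- then gives `27 * 1920`.
  have hstab : Nat.card (MulAction.stabilizer G (halfPoint 6 1)) = 1920 := by
    have hbij : Function.Bijective (fun g : HalfCubeGroup 6 =>
        (⟨signedPermIsometry 6 le_rfl g, signedPermEquiv_apex g⟩ :
          MulAction.stabilizer G (halfPoint 6 1))) := by
      refine ⟨fun a b h => signedPermIsometry_injective le_rfl (congrArg Subtype.val h),
        fun ⟨f, hf⟩ => ?_⟩
      obtain ⟨g, hg⟩ := exists_signedPermEquiv_of_fix_apex le_rfl f.2 hf
      exact ⟨g, Subtype.ext (Subtype.ext hg)⟩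
    rw [← Nat.card_eq_of_bijective _ hbij, SemidirectProduct.card, Nat.card_perm]
    have := card_evenSigns_five
    simp [this]
    decide
  have h := Subgroup.card_mul_index (MulAction.stabilizer G (halfPoint 6 1))
  rw [hstab, MulAction.index_stabilizer, horb, ncard_layers_six] at h
  exact h.symm

/-! ### Identification of `P_6` with the Schläfli polytope -/

/-- The isometric embedding of `(ℝ⁶, q_6)` mapping `P_6` to the Schläfli polytope. -/
noncomputable def schlafliMap : Space 6 →ᵃ[ℝ] EuclideanSpace ℝ (Fin 8) where
  toFun p :=
    let x : Fin 5 → ℝ := p.1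
    -- The first three coordinates parametrize `v 0 + v 1 = v 0 + v 2 = 1`; their three slopes
    -- `±1/2` produce the coefficient `3/4` of `q_6`.
    !₂[(1 - p.2) / 2, (1 + p.2) / 2, (1 + p.2) / 2,
      1 / 2 - x 0, 1 / 2 - x 1, 1 / 2 - x 2, 1 / 2 - x 3, 1 / 2 - x 4]
  linear :=
    { toFun := fun p =>
        let x : Fin 5 → ℝ := p.1
        !₂[-p.2 / 2, p.2 / 2, p.2 / 2, -x 0, -x 1, -x 2, -x 3, -x 4]
      map_add' := fun p q => by
        ext i
        fin_cases i <;> simp <;> ring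
      map_smul' := fun a p => by
        ext i
        fin_cases i <;> simp <;> ring }
  map_vadd' := fun p v => by
    ext i
    fin_cases i <;> simp <;> ring

theorem schlafliMap_apply (x : Fin 5 → ℝ) (t : ℝ) :
    schlafliMap (x, t) = !₂[(1 - t) / 2, (1 + t) / 2, (1 + t) / 2,
      1 / 2 - x 0, 1 / 2 - x 1, 1 / 2 - x 2, 1 / 2 - x 3, 1 / 2 - x 4] := rfl

theorem norm_schlafliMap_sub (p p' : Space 6) :
    ‖schlafliMap p - schlafliMap p'‖ ^ 2 = formQ 6 (p - p') := by
  obtain ⟨x, t⟩ := p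
  obtain ⟨x', t'⟩ := p'
  rw [formQ_apply, EuclideanSpace.norm_sq_eq, schlafliMap_apply, schlafliMap_apply]
  change _ = ∑ i : Fin 5, (x i - x' i) ^ 2 + _
  simp [Fin.sum_univ_succ]
  ring

/-- The 27 roots whose convex hull is the Schläfli polytope. -/
theorem mem_schlafli_roots_iff (v : EuclideanSpace ℝ (Fin 8)) :
    (v ∈ rootsE8 ∧ inner ℝ v !₂[1, 1, 0, 0, 0, 0, 0, 0] = (1 : ℝ) ∧
      inner ℝ v !₂[1, 0, 1, 0, 0, 0, 0, 0] = (1 : ℝ)) ↔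
    ((∀ i, ∃ k : ℤ, v i = k) ∨ (∀ i, ∃ k : ℤ, v i = k + 1 / 2)) ∧
    (∃ k : ℤ, v 0 + v 1 + v 2 + v 3 + v 4 + v 5 + v 6 + v 7 = 2 * k) ∧
    v 0 ^ 2 + v 1 ^ 2 + v 2 ^ 2 + v 3 ^ 2 + v 4 ^ 2 + v 5 ^ 2 + v 6 ^ 2 + v 7 ^ 2 = 2 ∧
    v 0 + v 1 = 1 ∧ v 0 + v 2 = 1 := by
  simp only [rootsE8, Set.mem_ofPred_eq, EuclideanSpace.norm_sq_eq, PiLp.inner_apply,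
    Fin.sum_univ_eight, Real.norm_eq_abs, sq_abs]
  simp [and_assoc]

/-- The sphere equation is the norm condition, since the squared norm of the image is `formQ 6 (p -
center 6) + 2/3`, that is `4/3 + 2/3`. Even heights give half-odd-integer roots, odd heights integer
ones. -/
theorem schlafliMap_mem {p : Space 6} (hp : p ∈ layers 6) :
    schlafliMap p ∈ rootsE8 ∧ inner ℝ (schlafliMap p) !₂[1, 1, 0, 0, 0, 0, 0, 0] = (1 : ℝ) ∧
      inner ℝ (schlafliMap p) !₂[1, 0, 1, 0, 0, 0, 0, 0] = (1 : ℝ) := by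
  have hL := layers_subset_latticeL (by decide) le_rfl hp
  obtain ⟨k, z, ⟨t, ht⟩, rfl⟩ := mem_latticeL.1 hL
  have hs := layers_sphere le_rfl hp
  rw [formQ_sub_center (k : ℝ) (fun i => (z i : ℝ))] at hs
  change Fin 5 → ℤ at z
  change ∑ i : Fin 5, z i = t + t at ht
  change ∑ i : Fin 5, ((z i : ℝ) + ((k : ℝ) - 1) / 2) ^ 2 + _ = _ at hs
  have ht' : (∑ i : Fin 5, (z i : ℝ)) = t + t := by exact_mod_cast ht
  rw [Fin.sum_univ_five] at hs ht'
  rw [mem_schlafli_roots_iff, schlafliMap_apply]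
  refine ⟨?_, ⟨2 - k - t, ?_⟩, ?_, ?_, ?_⟩
  · rcases Int.even_or_odd' k with ⟨l, rfl | rfl⟩
    · right
      intro i
      fin_cases i
      · exact ⟨-l, by simp; ring⟩
      · exact ⟨l, by simp; ring⟩
      · exact ⟨l, by simp; ring⟩
      · exact ⟨-l - z 0, by simp; ring⟩
      · exact ⟨-l - z 1, by simp; ring⟩
      · exact ⟨-l - z 2, by simp; ring⟩
      · exact ⟨-l - z 3, by simp; ring⟩
      · exact ⟨-l - z 4, by simp; ring⟩
    · left
      intro i
      fin_cases i
      · exact ⟨-l, by simp; ring⟩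
      · exact ⟨l + 1, by simp; ring⟩
      · exact ⟨l + 1, by simp; ring⟩
      · exact ⟨-l - z 0, by simp; ring⟩
      · exact ⟨-l - z 1, by simp; ring⟩
      · exact ⟨-l - z 2, by simp; ring⟩
      · exact ⟨-l - z 3, by simp; ring⟩
      · exact ⟨-l - z 4, by simp; ring⟩
  · simp
    linarith
  · simp
    norm_num at hs
    linarith
  · simp; ring
  · simp; ring

/-- No enumeration of roots: the preimage is a lattice point on the empty sphere, so
`latticeL_sphere` places it in the layers. -/
theorem exists_schlafliMap_eq {v : EuclideanSpace ℝ (Fin 8)}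
    (hv : v ∈ rootsE8 ∧ inner ℝ v !₂[1, 1, 0, 0, 0, 0, 0, 0] = (1 : ℝ) ∧
      inner ℝ v !₂[1, 0, 1, 0, 0, 0, 0, 0] = (1 : ℝ)) :
    ∃ p ∈ layers 6, schlafliMap p = v := by
  obtain ⟨hint, ⟨t, ht⟩, hnorm, h1, h2⟩ := (mem_schlafli_roots_iff v).1 hv
  let x : Fin 5 → ℝ := ![1 / 2 - v 3, 1 / 2 - v 4, 1 / 2 - v 5, 1 / 2 - v 6, 1 / 2 - v 7]
  have hφ : schlafliMap (x, v 1 - v 0) = v := by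
    rw [schlafliMap_apply]
    ext i
    fin_cases i <;> simp [x] <;> linarith
  refine ⟨_, ?_, hφ⟩
  have hk : ∃ k : ℤ, v 1 - v 0 = k := by
    rcases hint with h | h
    · obtain ⟨a, ha⟩ := h 0
      exact ⟨1 - 2 * a, by push_cast; linarith⟩
    · obtain ⟨a, ha⟩ := h 0
      exact ⟨-2 * a, by push_cast; linarith⟩
  obtain ⟨k, hk⟩ := hk
  -- As `k = 1 - 2 * v 0`, the required integers are the differences `v 0 - v (i + 3)`, in either
  -- integrality class.
  have hz : ∀ i, ∃ z : ℤ, x i = z + (k : ℝ) / 2 := by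
    rcases hint with h | h
    all_goals
      choose a ha using h
      intro i
      have h0 := ha 0
    · fin_cases i
      · exact ⟨a 0 - a 3, by simp [x]; linarith [ha 3]⟩
      · exact ⟨a 0 - a 4, by simp [x]; linarith [ha 4]⟩
      · exact ⟨a 0 - a 5, by simp [x]; linarith [ha 5]⟩
      · exact ⟨a 0 - a 6, by simp [x]; linarith [ha 6]⟩
      · exact ⟨a 0 - a 7, by simp [x]; linarith [ha 7]⟩
    · fin_cases i
      · exact ⟨a 0 - a 3, by simp [x]; linarith [ha 3]⟩
      · exact ⟨a 0 - a 4, by simp [x]; linarith [ha 4]⟩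
      · exact ⟨a 0 - a 5, by simp [x]; linarith [ha 5]⟩
      · exact ⟨a 0 - a 6, by simp [x]; linarith [ha 6]⟩
      · exact ⟨a 0 - a 7, by simp [x]; linarith [ha 7]⟩
  choose z hz using hz
  have hp : ((x, v 1 - v 0) : Space 6) = (fun i => (z i : ℝ) + (k : ℝ) / 2, (k : ℝ)) := by
    rw [hk]
    exact Prod.ext (funext hz) rfl
  have hx0 := hz 0
  have hx1 := hz 1
  have hx2 := hz 2
  have hx3 := hz 3
  have hx4 := hz 4
  simp [x] at hx0 hx1 hx2 hx3 hx4
  refine (latticeL_sphere (by decide) le_rfl (mem_latticeL.2 ⟨k, z, ⟨2 - k - t, ?_⟩, hp⟩)).2 ?_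
  · change ∑ i : Fin 5, z i = _
    have : ∑ i : Fin 5, (z i : ℝ) = ((2 - k - t + (2 - k - t) : ℤ) : ℝ) := by
      rw [Fin.sum_univ_five]
      push_cast
      linarith
    exact_mod_cast this
  · rw [formQ_apply]
    change ∑ i : Fin 5, (x i - 1 / 2) ^ 2 + _ = _
    rw [Fin.sum_univ_five]
    have h0 : v 0 = 1 - v 1 := by linarith
    have h2' : v 2 = v 1 := by linarith
    rw [h0, h2'] at hnorm
    simp [x, center, halfPoint, h0]
    norm_num
    linarith

theorem image_schlafliMap : schlafliMap '' polytopeP 6 = schlafli := by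
  rw [polytopeP, schlafli, AffineMap.image_convexHull]
  congr 1
  ext v
  constructor
  · rintro ⟨p, hp, rfl⟩
    exact schlafliMap_mem hp
  · exact fun hv => exists_schlafliMap_eq hv

end ExtremeDelaunay

theorem theorem1 (n : ℕ) (hn : Even n) (h6 : 6 ≤ n) :
    -- (i)
    (IsDelaunayIn (formQ n) (latticeL n) (polytopeP n) ∧
      IsExtremeDelaunay (formQ n) (polytopeP n) ∧
      (∀ α : ℝ, 0 < α → IsDelaunayIn (α • formQ n) (latticeL n) (polytopeP n)) ∧
      (∀ (q : QuadraticForm ℝ (Space n)) (L : Submodule ℤ (Space n)),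
        IsDelaunayIn q L (polytopeP n) → ∃ α : ℝ, 0 < α ∧ q = α • formQ n)) ∧
    -- (ii)
    (∀ (c : Space n) (r : ℝ),
      IsDelaunaySphere (formQ n) (latticeL n) (polytopeP n) c r ↔
        c = halfPoint n (-1 / ((n : ℝ) - 3)) ∧
          r = ((n : ℝ) - 2) / (2 * Real.sqrt ((n : ℝ) - 3))) ∧
    -- (iii)
    (n = 6 →
      (∃ φ : Space n →ᵃ[ℝ] EuclideanSpace ℝ (Fin 8),
        (∀ x y, ‖φ x - φ y‖ ^ 2 = formQ n (x - y)) ∧ φ '' polytopeP n = schlafli) ∧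
      Nat.card (isometryGroup (formQ n) (polytopeP n)) = 51840 ∧
      ∀ v ∈ vertices (polytopeP n), ∀ w ∈ vertices (polytopeP n),
        ∃ f ∈ isometryGroup (formQ n) (polytopeP n), f v = w) ∧
    (6 < n →
      Nonempty (isometryGroup (formQ n) (polytopeP n) ≃*
        evenSigns (n - 1) ⋊[permSigns (n - 1)] Equiv.Perm (Fin (n - 1))) ∧
      (vertexOrbits (formQ n) (polytopeP n)).ncard = 3) := by
  refine ⟨⟨⟨_, _, isDelaunaySphere_polytopeP hn h6⟩, isExtremeDelaunay_polytopeP hn h6,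
    fun α hα => IsDelaunayIn.smul ⟨_, _, isDelaunaySphere_polytopeP hn h6⟩ hα,
    fun q L h => form_unique h6 h⟩, isDelaunaySphere_iff hn h6, ?_, fun h =>
    ⟨nonempty_isometryGroup_mulEquiv h, ncard_vertexOrbits h⟩⟩
  rintro rfl
  refine ⟨⟨schlafliMap, norm_schlafliMap_sub, image_schlafliMap⟩, card_isometryGroup_six,
    fun v hv w hw => ?_⟩
  rw [vertices, extremePoints_polytopeP h6] at hv hw
  exact isometryGroup_transitive hv hw
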